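/- Let $A$ be a finite alphabet and let $\mathbf X=(P_{X^n})_{n\ge 1}$ be an arbitrary (general) source, i.e. an arbitrary sequence of probability mass functions $P_{X^n}$ on $A^n$, with no consistency assumption; $\mathbf Y=(P_{Y^n})_{n\ge1}$ below also ranges over all sources on $A$. Logarithms are natural, $H$ is Shannon entropy, and $D(Q\|P)$ is Kullback–Leibler divergence ($+\infty$ unless $Q\ll P$). Define, for $\rho\ge 0$, $$E_u(\mathbf Y,\mathbf X,\rho)=\limsup_{n\to\infty}\tfrac1n\{\rho H(P_{Y^n})-D(P_{Y^n}\|P_{X^n})\},\qquad E_l(\mathbf Y,\mathbf X,\rho)=\liminf_{n\to\infty}\tfrac1n\{\rho H(P_{Y^n})-D(P_{Y^n}\|P_{X^n})\},$$ $$D_u(\mathbf Y\|\mathbf X)=\limsup_{n\to\infty}\tfrac1n D(P_{Y^n}\|P_{X^n}),$$ $$\overline H(\mathbf Y)=\inf\Big\{t:\lim_{n\to\infty}\Pr\{\tfrac1n\ln\tfrac1{P_{Y^n}(Y^n)}>t\}=0\Big\},\qquad \underline H(\mathbf Y)=\sup\Big\{t:\lim_{n\to\infty}\Pr\{\tfrac1n\ln\tfrac1{P_{Y^n}(Y^n)}<t\}=0\Big\}.$$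 *Compression.* A length function on $A^n$ is a map $L_n$ from $A^n$ to the nonnegative integers with $\sum_{x\in A^n}2^{-L_n(x)}\le1$. For $R,\rho>0$ let $$E_n^s(R,\rho)=\inf_{L_n}\tfrac1n\ln\mathbb E\big[\exp\{\rho\min\{L_n(X^n)\ln2,\,nR\}\}\big],$$ the infimum over all length functions, and $E_u^s=\limsup_n E_n^s$, $E_l^s=\liminf_n E_n^s$. *Guessing.* Let $k=\lceil nR/\ln 2\rceil$ and let $U^k$ be a uniformly random $k$-bit key independent of $X^n$. An encryption function is a map $f_n$ from $A^n\times\{0,1\}^k$ to the finite binary strings that is injective in the message for each fixed key; the cryptogram is $Y=f_n(X^n,U^k)$. Let $G_{f_n}(x\mid y)\in\{1,\dots,|A|^n\}$ be the position of $x$ when the messages are listed in decreasing order of their posterior probabilities given $Y=y$ (ties broken arbitrarily). Let $$E_n^g(R,\rho)=\sup_{f_n}\tfrac1n\ln\mathbb E\big[G_{f_n}(X^n\mid Y)^\rho\big],$$ and $E_u^g=\limsup_n E_n^g$, $E_l^g=\liminf_n E_n^g$. **Theorem.** For all $R>0$ and $\rho>0$, $$\max\Big\{\rho R-\inf_{\mathbf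 Y:\,\underline H(\mathbf Y)>R}D_u(\mathbf Y\|\mathbf X),\ \sup_{\mathbf Y:\,\overline H(\mathbf Y)\le R}E_l(\mathbf Y,\mathbf X,\rho)\Big\}\le E_l^s(R,\rho)\le E_u^s(R,\rho)\le\min_{0\le\theta\le\rho}\Big\{(\rho-\theta)R+\max_{\mathbf Y}E_u(\mathbf Y,\mathbf X,\theta)\Big\},$$ where an infimum over the empty set is $+\infty$, and the maximum over $\mathbf Y$ (for every $\theta\in[0,\rho]$) and the minimum over $\theta$ are attained. Moreover $E_l^g(R,\rho)=E_l^s(R,\rho)$ and $E_u^g(R,\rho)=E_u^s(R,\rho)$, so that the same bounds hold for the guessing exponents. -/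

import Mathlib

open Filter Topology

namespace GuessingWiretapper

noncomputable section

/-! ### Sources and information measures (all logarithms are natural) -/

/-- A general source with alphabet `A`: for each `n` a probability mass function on `Aⁿ`,
with no consistency required between different `n`. (For `n = 0` there is only one.) -/
abbrev Source (A : Type*) := ∀ n : ℕ, PMF (Fin n → A)

/-- Shannon entropy `H(P) = -∑ P(x) ln P(x)`, in nats. -/
def entropy {α : Type*} [Fintype α] (P : PMF α) : ℝ :=
  -∑ x, (P x).toReal * Real.log (P x).toReal

open Classical in
/-- Kullback-Leibler divergence `D(Q‖P)`; it is `+∞` unless `Q ≪ P`. Where `Q x = 0` the summand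
is `0`, as usual. -/
def divergence {α : Type*} [Fintype α] (Q P : PMF α) : EReal :=
  if ∀ x, P x = 0 → Q x = 0 then
    ((∑ x, (Q x).toReal * Real.log ((Q x).toReal / (P x).toReal) : ℝ) : EReal)
  else ⊤

/-- `(1/n) (ρ H(Yⁿ) - D(Yⁿ‖Xⁿ))`, with value `-∞` if `D(Yⁿ‖Xⁿ) = ∞`. -/
def normalizedGap {A : Type*} [Fintype A] (Y X : Source A) (ρ : ℝ) (n : ℕ) : EReal :=
  (((n : ℝ)⁻¹ : ℝ) : EReal) * (((ρ * entropy (Y n) : ℝ) : EReal) - divergence (Y n) (X n))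

/-- `E_u(Y, X, ρ)`. -/
def upperGap {A : Type*} [Fintype A] (Y X : Source A) (ρ : ℝ) : EReal :=
  limsup (fun n : ℕ => normalizedGap Y X ρ n) atTop

/-- `E_l(Y, X, ρ)`. -/
def lowerGap {A : Type*} [Fintype A] (Y X : Source A) (ρ : ℝ) : EReal :=
  liminf (fun n : ℕ => normalizedGap Y X ρ n) atTop

/-- The upper divergence `D_u(Y‖X) = limsup (1/n) D(Yⁿ‖Xⁿ)`. -/
def upperDivergence {A : Type*} [Fintype A] (Y X : Source A) : EReal :=
  limsup (fun n : ℕ => (((n : ℝ)⁻¹ : ℝ) : EReal) * divergence (Y n) (X n)) atTop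

/-- The normalized self-information `(1/n) ln (1 / P_{Yⁿ}(y))`. Its (junk) value at words of
probability zero does not matter: it is only used inside `P_{Yⁿ}`-probabilities. -/
def selfInformation {A : Type*} (Y : Source A) (n : ℕ) (y : Fin n → A) : ℝ :=
  (n : ℝ)⁻¹ * Real.log (1 / (Y n y).toReal)

/-- The spectral sup-entropy-rate: the infimum of all `θ` such that
`Pr {(1/n) ln (1 / P_{Yⁿ}(Yⁿ)) > θ} → 0`. -/
def supEntropyRate {A : Type*} (Y : Source A) : EReal :=
  ⨅ (θ : ℝ) (_ : Tendsto (fun n : ℕ => (Y n).toOuterMeasure {y | θ < selfInformation Y n y})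
    atTop (𝓝 0)), (θ : EReal)

/-- The spectral inf-entropy-rate: the supremum of all `θ` such that
`Pr {(1/n) ln (1 / P_{Yⁿ}(Yⁿ)) < θ} → 0`. -/
def infEntropyRate {A : Type*} (Y : Source A) : EReal :=
  ⨆ (θ : ℝ) (_ : Tendsto (fun n : ℕ => (Y n).toOuterMeasure {y | selfInformation Y n y < θ})
    atTop (𝓝 0)), (θ : EReal)

/-! ### The compression problem with saturated exponential cost -/

/-- A length function: it satisfies Kraft's inequality for the binary code alphabet. -/
def IsLengthFunction {α : Type*} [Fintype α] (L : α → ℕ) : Prop :=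
  ∑ x, (2 : ℝ)⁻¹ ^ L x ≤ 1

/-- `𝔼[exp (ρ min {L(Xⁿ) ln 2, nR})]`. -/
def compressionCost {A : Type*} [Fintype A] {n : ℕ} (P : PMF (Fin n → A)) (R ρ : ℝ)
    (L : (Fin n → A) → ℕ) : ℝ :=
  ∑ x, (P x).toReal * Real.exp (ρ * min ((L x : ℝ) * Real.log 2) ((n : ℝ) * R))

/-- `E_n^s(R, ρ)`: the least value, over all length functions, of the normalized log-cost. -/
def compressionExponent {A : Type*} [Fintype A] (X : Source A) (R ρ : ℝ) (n : ℕ) : EReal :=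
  ⨅ (L : (Fin n → A) → ℕ) (_ : IsLengthFunction L),
    (((n : ℝ)⁻¹ * Real.log (compressionCost (X n) R ρ L) : ℝ) : EReal)

/-- `E_u^s(R, ρ)`. -/
def upperCompressionExponent {A : Type*} [Fintype A] (X : Source A) (R ρ : ℝ) : EReal :=
  limsup (fun n : ℕ => compressionExponent X R ρ n) atTop

/-- `E_l^s(R, ρ)`. -/
def lowerCompressionExponent {A : Type*} [Fintype A] (X : Source A) (R ρ : ℝ) : EReal :=
  liminf (fun n : ℕ => compressionExponent X R ρ n) atTop

/-! ### The Shannon cipher system with a guessing wiretapper -/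

/-- The number of key bits used for blocklength `n` at key rate `R` nats per letter. -/
def keyLength (R : ℝ) (n : ℕ) : ℕ := ⌈(n : ℝ) * R / Real.log 2⌉₊

/-- An encryption function maps a message and a key of `k` bits to a cryptogram, a binary string
of variable length; for each fixed key it is invertible on its range. -/
def IsEncryption {α : Type*} {k : ℕ} (f : α → (Fin k → Bool) → List Bool) : Prop :=
  ∀ u, Function.Injective fun x => f x u

/-- The joint probability of message `x` and cryptogram `y`, for a uniform key independent of the
message. -/
def jointProb {α : Type*} {k : ℕ} (P : PMF α) (f : α → (Fin k → Bool) → List Bool)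
    (x : α) (y : List Bool) : ℝ :=
  (P x).toReal * (((Finset.univ.filter fun u => f x u = y).card : ℝ) / 2 ^ k)

/-- The posterior probability of message `x` given cryptogram `y` (`0` if `y` has probability
zero). -/
def posterior {α : Type*} [Fintype α] {k : ℕ} (P : PMF α) (f : α → (Fin k → Bool) → List Bool)
    (x : α) (y : List Bool) : ℝ :=
  jointProb P f x y / ∑ x', jointProb P f x' y

/-- A guessing strategy: for each cryptogram `y` an ordering of all messages. Message `x` is the
`(G y x + 1)`-th guess, since `Fin` counts from `0`. -/
abbrev GuessingStrategy (α : Type*) [Fintype α] := List Bool → (α ≃ Fin (Fintype.card α))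

/-- The attacker's optimal strategy against `f`: guess in decreasing order of the posterior
probabilities. (Ties may be broken in any way; the guessing moments do not depend on it.) -/
def IsOptimalAttack {α : Type*} [Fintype α] {k : ℕ} (P : PMF α)
    (f : α → (Fin k → Bool) → List Bool) (G : GuessingStrategy α) : Prop :=
  ∀ y x x', G y x < G y x' → posterior P f x' y ≤ posterior P f x y

/-- The guessing moment `𝔼[G(X | Y)^ρ]`, where `Y = f(X, U)` and the key `U` is uniform and
independent of `X`. -/
def guessingMoment {α : Type*} [Fintype α] {k : ℕ} (P : PMF α)
    (f : α → (Fin k → Bool) → List Bool) (G : GuessingStrategy α) (ρ : ℝ) : ℝ :=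
  ∑ x, ∑ u, (P x).toReal * (1 / 2 ^ k) * (((G (f x u) x : ℕ) : ℝ) + 1) ^ ρ

/-- `E_n^g(R, ρ)`: the supremum, over all encryption functions, of the normalized logarithm of the
guessing moment of the optimal attack. -/
def guessingExponent {A : Type*} [Fintype A] (X : Source A) (R ρ : ℝ) (n : ℕ) : EReal :=
  ⨆ (f : (Fin n → A) → (Fin (keyLength R n) → Bool) → List Bool) (_ : IsEncryption f)
    (G : GuessingStrategy (Fin n → A)) (_ : IsOptimalAttack (X n) f G),
    (((n : ℝ)⁻¹ * Real.log (guessingMoment (X n) f G ρ) : ℝ) : EReal)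

/-- `E_u^g(R, ρ)`. -/
def upperGuessingExponent {A : Type*} [Fintype A] (X : Source A) (R ρ : ℝ) : EReal :=
  limsup (fun n : ℕ => guessingExponent X R ρ n) atTop

/-- `E_l^g(R, ρ)`. -/
def lowerGuessingExponent {A : Type*} [Fintype A] (X : Source A) (R ρ : ℝ) : EReal :=
  liminf (fun n : ℕ => guessingExponent X R ρ n) atTop

end

end GuessingWiretapper

open GuessingWiretapper

namespace GuessingWiretapper

/-! ### Finite alphabets: divergence, the Gibbs inequality, tilting -/

/-! Lower bounds. By the Gibbs variational inequality (`sum_sub_realDivergence_le_log`), the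
log-cost of any code under `P` is at least `ρ` times its saturated mean length under any `Q ≪ P`,
minus `D(Q‖P)`. So only the saturated mean length under `Q = P_{Yⁿ}` has to be bounded below. If the
self-information of `Q` rarely exceeds the saturation level, saturation hardly helps, and the
entropy is a bound up to a constant and a small fraction of `n` (`entropy_sub_le_sum_min`). If it is
mostly well above that level, Kraft's inequality leaves little mass for short codewords, and the
mean is almost `nR` (`mul_sub_le_sum_min`).

Upper bound. A minimum is at most any convex combination of its two arguments, which gives `ρ min{a,
M} ≤ (ρ - θ) M + θ a`. The remaining linear exponential cost is nearly optimized by the Shannon code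
of the pmf proportional to `P^{1/(1+θ)}` (`exists_isLengthFunction_cost_le`). This same pmf
maximizes `θ H(Q) - D(Q‖P)`, and the maximum is the exponent obtained. The bound is Lipschitz in
`θ`, so a minimum exists.

Guessing. The attacker who tries short codewords and decryptions of the cryptogram first needs at
most `2 · 2^min(L, k)` guesses (`exists_guessingStrategy_le`), so the moment is at most a constant
times the cost of any code. Conversely, sort the messages by probability, cut the list into blocks
of `2^k` and apply a one-time pad inside each block (`exists_encryption_le_guessingMoment`). The
cryptogram reveals only the block, so the guess number is about the rank modulo `2^k`. For
decreasing weights this loses only a factor `ρ + 2` against the rank saturated at `2^k`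
(`sum_min_rpow_le_sum_mod_rpow`), and coding the ranks costs only a further factor polynomial in `n`
(`exists_isLengthFunction_rank`). -/

theorem toReal_eq_zero_iff {α : Type*} (P : PMF α) (x : α) : (P x).toReal = 0 ↔ P x = 0 := by
  simp [ENNReal.toReal_eq_zero_iff, P.apply_ne_top x]

section Finite

variable {α : Type*} [Fintype α]

theorem sum_toReal_eq_one (P : PMF α) : ∑ x, (P x).toReal = 1 := by
  rw [← ENNReal.toReal_sum fun x _ => P.apply_ne_top x]
  have h := P.tsum_coe
  rw [tsum_fintype] at h
  rw [h, ENNReal.toReal_one]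

theorem toReal_apply_le_one (P : PMF α) (x : α) : (P x).toReal ≤ 1 := by
  rw [← sum_toReal_eq_one P]
  exact Finset.single_le_sum (f := fun x => (P x).toReal)
    (fun _ _ => ENNReal.toReal_nonneg) (Finset.mem_univ x)

theorem exists_pmf_toReal_eq (w : α → ℝ) (h0 : ∀ x, 0 ≤ w x) (h1 : ∑ x, w x = 1) :
    ∃ Q : PMF α, ∀ x, (Q x).toReal = w x := by
  refine ⟨PMF.ofFintype (fun x => ENNReal.ofReal (w x)) ?_, fun x => ?_⟩
  · rw [← ENNReal.ofReal_sum_of_nonneg fun x _ => h0 x, h1, ENNReal.ofReal_one]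
  · simp [PMF.ofFintype_apply, ENNReal.toReal_ofReal (h0 x)]

/-- The divergence as a real number; it is meaningful only if `Q ≪ P`. -/
noncomputable def realDivergence (Q P : PMF α) : ℝ :=
  ∑ x, (Q x).toReal * Real.log ((Q x).toReal / (P x).toReal)

theorem divergence_of_ac {Q P : PMF α} (h : ∀ x, P x = 0 → Q x = 0) :
    divergence Q P = (realDivergence Q P : EReal) := by
  simp only [divergence, if_pos h, realDivergence]

theorem divergence_of_not_ac {Q P : PMF α} (h : ¬ ∀ x, P x = 0 → Q x = 0) :
    divergence Q P = ⊤ := by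
  simp only [divergence, if_neg h]

/-- This is `log t ≤ t - 1` at `t = w / q`. Summed against a suitable weight `w`, it yields the
Gibbs inequality and all the entropy bounds below. -/
theorem sub_le_mul_log_sub_log {q w : ℝ} (hq : 0 ≤ q) (hw : 0 < w) :
    q - w ≤ q * (Real.log q - Real.log w) := by
  rcases hq.eq_or_lt with rfl | hq
  · simpa using hw.le
  · have h := Real.log_le_sub_one_of_pos (div_pos hw hq)
    rw [Real.log_div hw.ne' hq.ne'] at h
    have h2 := mul_le_mul_of_nonneg_left h hq.le
    have h3 : q * (w / q - 1) = w - q := by field_simp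
    linarith

theorem realDivergence_eq {Q P : PMF α} (h : ∀ x, P x = 0 → Q x = 0) :
    realDivergence Q P
      = ∑ x, (Q x).toReal * (Real.log (Q x).toReal - Real.log (P x).toReal) := by
  refine Finset.sum_congr rfl fun x _ => ?_
  rcases eq_or_ne (Q x).toReal 0 with hq | hq
  · simp [hq]
  · have hp : (P x).toReal ≠ 0 := fun hp =>
      hq ((toReal_eq_zero_iff Q x).2 (h x ((toReal_eq_zero_iff P x).1 hp)))
    rw [Real.log_div hq hp]

theorem sum_mul_exp_pos (P : PMF α) (g : α → ℝ) : 0 < ∑ x, (P x).toReal * Real.exp (g x) := by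
  have h0 : ∀ x ∈ Finset.univ, 0 ≤ (P x).toReal * Real.exp (g x) := fun x _ => by positivity
  refine (Finset.sum_nonneg h0).lt_of_ne fun h => ?_
  have h1 := (Finset.sum_eq_zero_iff_of_nonneg h0).1 h.symm
  have h2 : ∑ x, (P x).toReal = 0 := Finset.sum_eq_zero fun x hx => by
    simpa [(Real.exp_pos (g x)).ne'] using h1 x hx
  rw [sum_toReal_eq_one] at h2
  exact one_ne_zero h2

/-- The Gibbs variational inequality. -/
theorem sum_sub_realDivergence_le_log {Q P : PMF α} (h : ∀ x, P x = 0 → Q x = 0) (g : α → ℝ) :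
    ∑ x, (Q x).toReal * g x - realDivergence Q P
      ≤ Real.log (∑ x, (P x).toReal * Real.exp (g x)) := by
  set Z := ∑ x, (P x).toReal * Real.exp (g x) with hZ
  have hZ0 : 0 < Z := sum_mul_exp_pos P g
  -- The weight is the Gibbs pmf `P e^g / Z`, so summing says that the divergence of `Q` from it is
  -- nonnegative.
  have key : ∀ x, (Q x).toReal - (P x).toReal * Real.exp (g x) / Z
      ≤ (Q x).toReal * (Real.log (Q x).toReal - Real.log (P x).toReal)
        - (Q x).toReal * g x + (Q x).toReal * Real.log Z := by
    intro x
    rcases eq_or_ne (P x).toReal 0 with hp | hp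
    · have hq : (Q x).toReal = 0 := (toReal_eq_zero_iff Q x).2 (h x ((toReal_eq_zero_iff P x).1 hp))
      simp [hp, hq]
    · have hp' : 0 < (P x).toReal := lt_of_le_of_ne ENNReal.toReal_nonneg hp.symm
      have h1 := sub_le_mul_log_sub_log (q := (Q x).toReal) ENNReal.toReal_nonneg
        (w := (P x).toReal * Real.exp (g x) / Z) (by positivity)
      rw [Real.log_div (by positivity) hZ0.ne', Real.log_mul hp (Real.exp_pos _).ne',
        Real.log_exp] at h1
      linarith
  have hsum := Finset.sum_le_sum fun x (_ : x ∈ Finset.univ) => key x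
  rw [Finset.sum_sub_distrib, ← Finset.sum_div, ← hZ, div_self hZ0.ne', sum_toReal_eq_one,
    Finset.sum_add_distrib, Finset.sum_sub_distrib, ← realDivergence_eq h, ← Finset.sum_mul,
    sum_toReal_eq_one] at hsum
  linarith

theorem realDivergence_nonneg {Q P : PMF α} (h : ∀ x, P x = 0 → Q x = 0) :
    0 ≤ realDivergence Q P := by
  have := sum_sub_realDivergence_le_log h fun _ => 0
  simp [sum_toReal_eq_one] at this
  exact this

theorem realDivergence_self (P : PMF α) : realDivergence P P = 0 := by
  rw [realDivergence_eq fun _ h => h]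
  simp

theorem entropy_nonneg (P : PMF α) : 0 ≤ entropy P := by
  rw [entropy, neg_nonneg]
  exact Finset.sum_nonpos fun x _ => mul_nonpos_of_nonneg_of_nonpos ENNReal.toReal_nonneg
    (Real.log_nonpos ENNReal.toReal_nonneg (toReal_apply_le_one P x))

/-- The part of `-∑ Q ln Q` outside of a set of large probability is small. -/
theorem neg_sum_mul_log_le [Nonempty α] (Q : PMF α) (T : Finset α) :
    -∑ x ∈ T, (Q x).toReal * Real.log (Q x).toReal
      ≤ 1 - ∑ x ∈ T, (Q x).toReal + (∑ x ∈ T, (Q x).toReal) * Real.log (Fintype.card α) := by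
  have hN : (0 : ℝ) < Fintype.card α := by exact_mod_cast Fintype.card_pos
  -- Comparison with the uniform pmf, whose mass on `T` is at most `1`.
  have h := Finset.sum_le_sum fun x (_ : x ∈ T) =>
    sub_le_mul_log_sub_log (q := (Q x).toReal) ENNReal.toReal_nonneg (inv_pos.2 hN)
  have hT : (T.card : ℝ) * (Fintype.card α : ℝ)⁻¹ ≤ 1 := by
    rw [← div_eq_mul_inv, div_le_one hN]
    exact_mod_cast T.card_le_univ
  simp only [Real.log_inv, sub_neg_eq_add, mul_add, Finset.sum_sub_distrib, Finset.sum_const,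
    nsmul_eq_mul, Finset.sum_add_distrib, ← Finset.sum_mul] at h
  linarith

theorem entropy_le_log_card [Nonempty α] (P : PMF α) : entropy P ≤ Real.log (Fintype.card α) := by
  have := neg_sum_mul_log_le P Finset.univ
  rwa [sum_toReal_eq_one, sub_self, zero_add, one_mul] at this

/-- The normalizing sum of the tilted distribution. -/
noncomputable def tiltedSum (P : PMF α) (θ : ℝ) : ℝ := ∑ x, (P x).toReal ^ (1 / (1 + θ))

theorem tiltedSum_pos (P : PMF α) {θ : ℝ} (hθ : 0 ≤ θ) : 0 < tiltedSum P θ := by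
  have h : ∑ x, (P x).toReal ≤ tiltedSum P θ := Finset.sum_le_sum fun x _ =>
    Real.self_le_rpow_of_le_one ENNReal.toReal_nonneg (toReal_apply_le_one P x)
      (by rw [div_le_one (by positivity)]; linarith)
  rw [sum_toReal_eq_one] at h
  linarith

/-- With `T` the pmf proportional to `P^{1/(1+θ)}`, the right side minus the left side is `(1 + θ)
D(Q‖T)`. -/
theorem gap_le_log_tiltedSum {Q P : PMF α} (h : ∀ x, P x = 0 → Q x = 0) {θ : ℝ} (hθ : 0 ≤ θ) :
    θ * entropy Q - realDivergence Q P ≤ (1 + θ) * Real.log (tiltedSum P θ) := by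
  have hS := tiltedSum_pos P hθ
  have hθ' : 0 < 1 + θ := by linarith
  have key : ∀ x, (1 + θ) * ((Q x).toReal - (P x).toReal ^ (1 / (1 + θ)) / tiltedSum P θ)
      ≤ θ * ((Q x).toReal * Real.log (Q x).toReal)
        + (Q x).toReal * (Real.log (Q x).toReal - Real.log (P x).toReal)
        + (Q x).toReal * ((1 + θ) * Real.log (tiltedSum P θ)) := by
    intro x
    rcases eq_or_ne (P x).toReal 0 with hp | hp
    · have hq : (Q x).toReal = 0 := (toReal_eq_zero_iff Q x).2 (h x ((toReal_eq_zero_iff P x).1 hp))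
      have : (1 + θ)⁻¹ ≠ 0 := (inv_pos.2 hθ').ne'
      simp [hp, hq, Real.zero_rpow this]
    · have hp' : 0 < (P x).toReal := lt_of_le_of_ne ENNReal.toReal_nonneg hp.symm
      have h1 := sub_le_mul_log_sub_log (q := (Q x).toReal) ENNReal.toReal_nonneg
        (w := (P x).toReal ^ (1 / (1 + θ)) / tiltedSum P θ) (by positivity)
      rw [Real.log_div (by positivity) hS.ne', Real.log_rpow hp'] at h1
      refine (mul_le_mul_of_nonneg_left h1 hθ'.le).trans (le_of_eq ?_)
      field_simp
      ring
  have hsum := Finset.sum_le_sum fun x (_ : x ∈ Finset.univ) => key x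
  rw [← Finset.mul_sum, Finset.sum_sub_distrib, ← Finset.sum_div, ← tiltedSum, div_self hS.ne',
    sum_toReal_eq_one, Finset.sum_add_distrib, Finset.sum_add_distrib, ← realDivergence_eq h,
    ← Finset.sum_mul, sum_toReal_eq_one, ← Finset.mul_sum] at hsum
  rw [entropy]
  linarith

/-- The tilted distribution attains `max_Q (θ H(Q) - D(Q‖P))`. -/
theorem exists_tilted (P : PMF α) {θ : ℝ} (hθ : 0 ≤ θ) :
    ∃ T : PMF α, (∀ x, P x = 0 → T x = 0) ∧
      θ * entropy T - realDivergence T P = (1 + θ) * Real.log (tiltedSum P θ) := by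
  have hS := tiltedSum_pos P hθ
  have hθ' : 0 < 1 + θ := by linarith
  obtain ⟨T, hT⟩ := exists_pmf_toReal_eq (fun x => (P x).toReal ^ (1 / (1 + θ)) / tiltedSum P θ)
    (fun x => by positivity) (by rw [← Finset.sum_div, ← tiltedSum, div_self hS.ne'])
  have hac : ∀ x, P x = 0 → T x = 0 := fun x hx => by
    rw [← toReal_eq_zero_iff, hT, (toReal_eq_zero_iff P x).2 hx, Real.zero_rpow, zero_div]
    positivity
  refine ⟨T, hac, ?_⟩
  have key : ∀ x, θ * ((T x).toReal * Real.log (T x).toReal)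
        + (T x).toReal * (Real.log (T x).toReal - Real.log (P x).toReal)
      = (T x).toReal * (-((1 + θ) * Real.log (tiltedSum P θ))) := by
    intro x
    rcases eq_or_ne (P x).toReal 0 with hp | hp
    · simp [(toReal_eq_zero_iff T x).2 (hac x ((toReal_eq_zero_iff P x).1 hp))]
    · have hp' : 0 < (P x).toReal := lt_of_le_of_ne ENNReal.toReal_nonneg hp.symm
      have : Real.log (T x).toReal
          = 1 / (1 + θ) * Real.log (P x).toReal - Real.log (tiltedSum P θ) := by
        rw [hT, Real.log_div (by positivity) hS.ne', Real.log_rpow hp']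
      rw [this]
      field_simp
      ring
  have hsum := Finset.sum_congr rfl fun x (_ : x ∈ Finset.univ) => key x
  rw [Finset.sum_add_distrib, ← realDivergence_eq hac, ← Finset.sum_mul, sum_toReal_eq_one,
    ← Finset.mul_sum] at hsum
  rw [entropy]
  linarith

/-! ### Length functions -/

/-- Shannon code lengths: rounding `-log₂ w` up preserves Kraft's inequality and costs at most one
bit. -/
theorem exists_isLengthFunction (w : α → ℝ) (h0 : ∀ x, 0 < w x) (h1 : ∑ x, w x ≤ 1) :
    ∃ L : α → ℕ, IsLengthFunction L ∧
      ∀ x, (L x : ℝ) * Real.log 2 ≤ -Real.log (w x) + Real.log 2 := by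
  have hl2 : 0 < Real.log 2 := Real.log_pos one_lt_two
  have hw1 : ∀ x, w x ≤ 1 := fun x =>
    (Finset.single_le_sum (fun i _ => (h0 i).le) (Finset.mem_univ x)).trans h1
  refine ⟨fun x => ⌈-Real.log (w x) / Real.log 2⌉₊, ?_, fun x => ?_⟩
  · refine (Finset.sum_le_sum fun x _ => ?_).trans h1
    have h : -Real.log (w x) ≤ (⌈-Real.log (w x) / Real.log 2⌉₊ : ℝ) * Real.log 2 := by
      rw [← div_le_iff₀ hl2]
      exact Nat.le_ceil _
    rw [← Real.log_le_log_iff (by positivity) (h0 x), Real.log_pow, Real.log_inv]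
    linarith
  · have hn : 0 ≤ -Real.log (w x) / Real.log 2 :=
      div_nonneg (neg_nonneg.2 (Real.log_nonpos (h0 x).le (hw1 x))) hl2.le
    have h := (Nat.ceil_lt_add_one hn).le
    have := mul_le_mul_of_nonneg_right h hl2.le
    rwa [add_mul, div_mul_cancel₀ _ hl2.ne', one_mul] at this

/-- Each counted word contributes at least `2^(-m)` to the Kraft sum. -/
theorem card_filter_le_of_isLengthFunction {L : α → ℕ} (hL : IsLengthFunction L) (m : ℕ) :
    (Finset.univ.filter fun x => L x ≤ m).card ≤ 2 ^ m := by
  have h : ((Finset.univ.filter fun x => L x ≤ m).card : ℝ) * (2 : ℝ)⁻¹ ^ m ≤ 1 := by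
    refine le_trans ?_ hL
    rw [← nsmul_eq_mul, ← Finset.sum_const]
    refine (Finset.sum_le_sum fun x hx => ?_).trans
      (Finset.sum_le_sum_of_subset_of_nonneg (Finset.filter_subset _ _)
        fun x _ _ => by positivity)
    exact pow_le_pow_of_le_one (by norm_num) (by norm_num) (Finset.mem_filter.1 hx).2
  rw [inv_pow, ← div_eq_mul_inv, div_le_one (by positivity)] at h
  exact_mod_cast h

/-- Chernoff-type coding bound: a length function built from the tilted distribution. -/
theorem exists_isLengthFunction_cost_le [Nonempty α] (P : PMF α) {θ ρ M : ℝ} (hθ : 0 ≤ θ)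
    (hθρ : θ ≤ ρ) :
    ∃ L : α → ℕ, IsLengthFunction L ∧
      Real.log (∑ x, (P x).toReal * Real.exp (ρ * min ((L x : ℝ) * Real.log 2) M))
        ≤ (ρ - θ) * M + (1 + θ) * Real.log (tiltedSum P θ) + 2 * θ * Real.log 2 := by
  have hS := tiltedSum_pos P hθ
  have hθ' : 0 < 1 + θ := by linarith
  have hN : (0 : ℝ) < Fintype.card α := by exact_mod_cast Fintype.card_pos
  -- Mixing with the uniform pmf makes the weights positive even where `P` vanishes. The factor
  -- `1/2` costs a second bit besides the one for rounding, whence `2 * θ * log 2`.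
  obtain ⟨L, hL, hLw⟩ := exists_isLengthFunction
    (fun x => ((P x).toReal ^ (1 / (1 + θ)) / tiltedSum P θ + (Fintype.card α : ℝ)⁻¹) / 2)
    (fun x => by positivity) (by
      rw [← Finset.sum_div, Finset.sum_add_distrib, ← Finset.sum_div, ← tiltedSum,
        div_self hS.ne', Finset.sum_const, nsmul_eq_mul, Finset.card_univ,
        mul_inv_cancel₀ hN.ne']
      norm_num)
  refine ⟨L, hL, ?_⟩
  have key : ∀ x, (P x).toReal * Real.exp (ρ * min ((L x : ℝ) * Real.log 2) M)
      ≤ (P x).toReal ^ (1 / (1 + θ))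
        * Real.exp ((ρ - θ) * M + θ * Real.log (tiltedSum P θ) + 2 * θ * Real.log 2) := by
    intro x
    rcases eq_or_ne (P x).toReal 0 with hp | hp
    · rw [hp, zero_mul]; positivity
    · have hp' : 0 < (P x).toReal := lt_of_le_of_ne ENNReal.toReal_nonneg hp.symm
      have hl : (L x : ℝ) * Real.log 2 ≤ -(1 / (1 + θ) * Real.log (P x).toReal)
          + Real.log (tiltedSum P θ) + 2 * Real.log 2 := by
        have h1 := hLw x
        have h2 : Real.log ((P x).toReal ^ (1 / (1 + θ)) / tiltedSum P θ / 2)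
            ≤ Real.log (((P x).toReal ^ (1 / (1 + θ)) / tiltedSum P θ
              + (Fintype.card α : ℝ)⁻¹) / 2) := by
          apply Real.log_le_log (by positivity)
          gcongr
          exact le_add_of_nonneg_right (by positivity)
        rw [Real.log_div (by positivity) two_ne_zero, Real.log_div (by positivity) hS.ne',
          Real.log_rpow hp'] at h2
        linarith
      have hmin : ρ * min ((L x : ℝ) * Real.log 2) M
          ≤ (ρ - θ) * M + θ * ((L x : ℝ) * Real.log 2) := by
        have h1 := mul_le_mul_of_nonneg_left (min_le_right ((L x : ℝ) * Real.log 2) M)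
          (sub_nonneg.2 hθρ)
        have h2 := mul_le_mul_of_nonneg_left (min_le_left ((L x : ℝ) * Real.log 2) M) hθ
        linarith
      have h3 := mul_le_mul_of_nonneg_left hl hθ
      have h4 : Real.log (P x).toReal + ρ * min ((L x : ℝ) * Real.log 2) M
          ≤ 1 / (1 + θ) * Real.log (P x).toReal
            + ((ρ - θ) * M + θ * Real.log (tiltedSum P θ) + 2 * θ * Real.log 2) := by
        -- Since `1 = 1/(1+θ) + θ/(1+θ)`, the codeword length cancels all but the power `1/(1+θ)` of
        -- `P x`.
        have : Real.log (P x).toReal = 1 / (1 + θ) * Real.log (P x).toReal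
            + θ * (1 / (1 + θ) * Real.log (P x).toReal) := by field_simp
        linarith
      have h5 := Real.exp_le_exp.2 h4
      rw [Real.exp_add, Real.exp_log hp', Real.exp_add, mul_comm (1 / (1 + θ)),
        ← Real.rpow_def_of_pos hp'] at h5
      exact h5
  have hsum := Finset.sum_le_sum fun x (_ : x ∈ Finset.univ) => key x
  rw [← Finset.sum_mul, ← tiltedSum] at hsum
  have hlog := Real.log_le_log (sum_mul_exp_pos P _) hsum
  rw [Real.log_mul hS.ne' (Real.exp_pos _).ne', Real.log_exp] at hlog
  linarith

/-- If `Q` has most of its mass on words of probability at least `exp (-M)`, then saturation at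
`M` does not help much to code below the entropy. -/
theorem entropy_sub_le_sum_min [Nonempty α] [DecidableEq α] (Q : PMF α) {L : α → ℕ}
    (hL : IsLengthFunction L) {M : ℝ} (hM : 0 ≤ M) (T : Finset α)
    (hT : ∀ x ∈ T, Q x ≠ 0 → Real.exp (-M) ≤ (Q x).toReal) :
    entropy Q - 3 - (∑ x ∈ Tᶜ, (Q x).toReal) * Real.log (Fintype.card α)
      ≤ ∑ x, (Q x).toReal * min ((L x : ℝ) * Real.log 2) M := by
  have hq : ∀ x, 0 ≤ (Q x).toReal := fun x => ENNReal.toReal_nonneg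
  set m : α → ℝ := fun x => min ((L x : ℝ) * Real.log 2) M with hm
  have hm0 : ∀ x, 0 ≤ m x := fun x => le_min (by positivity) hM
  -- Words of mass zero are dropped because `hT` does not bound their number; they do not affect the
  -- sums weighted by `Q`.
  set T' := T.filter fun x => Q x ≠ 0 with hT'
  have hexp : ∀ x, Real.exp (-m x) ≤ (2 : ℝ)⁻¹ ^ L x + Real.exp (-M) := by
    intro x
    rcases min_choice ((L x : ℝ) * Real.log 2) M with h | h
    · have : Real.exp (-m x) = (2 : ℝ)⁻¹ ^ L x := by
        simp only [hm, h]
        rw [Real.exp_neg, Real.exp_nat_mul, Real.exp_log two_pos, inv_pow]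
      rw [this]
      linarith [Real.exp_pos (-M)]
    · simp only [hm, h]
      linarith [pow_pos (inv_pos.2 (two_pos : (0 : ℝ) < 2)) (L x)]
  have hcard : ∑ x ∈ T', Real.exp (-M) ≤ 1 := by
    refine (Finset.sum_le_sum fun x hx => hT x (Finset.mem_filter.1 hx).1
      (Finset.mem_filter.1 hx).2).trans ?_
    rw [← sum_toReal_eq_one Q]
    exact Finset.sum_le_sum_of_subset_of_nonneg (Finset.subset_univ _) fun x _ _ => hq x
  have h2 : ∑ x ∈ T', Real.exp (-m x) ≤ 2 := by
    have h3 : ∑ x ∈ T', (2 : ℝ)⁻¹ ^ L x ≤ 1 := le_trans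
      (Finset.sum_le_sum_of_subset_of_nonneg (Finset.subset_univ _) fun x _ _ => by positivity) hL
    have := Finset.sum_le_sum fun x (_ : x ∈ T') => hexp x
    rw [Finset.sum_add_distrib] at this
    linarith
  -- The saturated lengths nearly satisfy Kraft's inequality on `T'`: `e^(-m)` sums to at most `2`,
  -- one unit from the code and one from the at most `e^M` words. Together with the `1` lost on `Tᶜ`
  -- this is the constant `3`.
  have h4 := Finset.sum_le_sum fun x (_ : x ∈ T') =>
    sub_le_mul_log_sub_log (hq x) (Real.exp_pos (-m x))
  simp only [Real.log_exp, sub_neg_eq_add, mul_add, Finset.sum_sub_distrib,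
    Finset.sum_add_distrib] at h4
  have hz : ∀ g : α → ℝ, ∑ x ∈ T', (Q x).toReal * g x = ∑ x ∈ T, (Q x).toReal * g x := fun g =>
    Finset.sum_filter_of_ne fun x _ hne hx => hne (by simp [hx])
  rw [hz, hz] at h4
  have h5 : 0 ≤ ∑ x ∈ T', (Q x).toReal := Finset.sum_nonneg fun x _ => hq x
  have h6 := neg_sum_mul_log_le Q Tᶜ
  have h7 : 0 ≤ ∑ x ∈ Tᶜ, (Q x).toReal := Finset.sum_nonneg fun x _ => hq x
  have h8 : 0 ≤ ∑ x ∈ Tᶜ, (Q x).toReal * m x :=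
    Finset.sum_nonneg fun x _ => mul_nonneg (hq x) (hm0 x)
  rw [entropy, ← Finset.sum_add_sum_compl T, ← Finset.sum_add_sum_compl T
    fun x => (Q x).toReal * m x]
  linarith

/-- If `Q` has most of its mass on words of probability at most `exp (-c)`, then most of its mass
is on words with codewords longer than `M < c`. -/
theorem mul_sub_le_sum_min [DecidableEq α] (Q : PMF α) {L : α → ℕ}
    (hL : IsLengthFunction L) {M c : ℝ} (hM : 0 ≤ M) (B : Finset α) (hB : ∀ x ∈ B, (Q x).toReal ≤ Real.exp (-c)) :
    M * (1 - ∑ x ∈ Bᶜ, (Q x).toReal - Real.exp (M - c))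
      ≤ ∑ x, (Q x).toReal * min ((L x : ℝ) * Real.log 2) M := by
  have hq : ∀ x, 0 ≤ (Q x).toReal := fun x => ENNReal.toReal_nonneg
  -- A word with a codeword shorter than `M` has mass at most `e^(-c) ≤ e^(M-c) 2^(-L)`, so Kraft's
  -- inequality bounds the total mass of these words by `e^(M-c)`.
  have key : ∀ x ∈ B, (Q x).toReal * M - M * (Real.exp (M - c) * (2 : ℝ)⁻¹ ^ L x)
      ≤ (Q x).toReal * min ((L x : ℝ) * Real.log 2) M := by
    intro x hx
    rcases le_total M ((L x : ℝ) * Real.log 2) with h | h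
    · rw [min_eq_right h]
      linarith [show 0 ≤ M * (Real.exp (M - c) * (2 : ℝ)⁻¹ ^ L x) by positivity]
    · rw [min_eq_left h]
      have h1 : (Q x).toReal ≤ Real.exp (M - c) * (2 : ℝ)⁻¹ ^ L x := by
        have : (2 : ℝ)⁻¹ ^ L x = Real.exp (-((L x : ℝ) * Real.log 2)) := by
          rw [Real.exp_neg, Real.exp_nat_mul, Real.exp_log two_pos, inv_pow]
        rw [this, ← Real.exp_add]
        exact (hB x hx).trans (Real.exp_le_exp.2 (by linarith))
      have h2 := mul_le_mul_of_nonneg_left h1 hM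
      have h3 : 0 ≤ (Q x).toReal * ((L x : ℝ) * Real.log 2) := by positivity
      linarith
  have hsum := Finset.sum_le_sum key
  rw [Finset.sum_sub_distrib, ← Finset.sum_mul, ← Finset.mul_sum, ← Finset.mul_sum] at hsum
  have h1 : M * (Real.exp (M - c) * ∑ x ∈ B, (2 : ℝ)⁻¹ ^ L x) ≤ M * (Real.exp (M - c) * 1) := by
    gcongr
    exact (Finset.sum_le_sum_of_subset_of_nonneg (Finset.subset_univ _)
      fun x _ _ => by positivity).trans hL
  have h2 := Finset.sum_add_sum_compl B fun x => (Q x).toReal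
  rw [sum_toReal_eq_one] at h2
  have h3 : 0 ≤ ∑ x ∈ Bᶜ, (Q x).toReal * min ((L x : ℝ) * Real.log 2) M :=
    Finset.sum_nonneg fun x _ => mul_nonneg (hq x) (le_min (by positivity) hM)
  have h4 : (∑ x ∈ B, (Q x).toReal) * M = M * (1 - ∑ x ∈ Bᶜ, (Q x).toReal) := by
    rw [← h2]; ring
  rw [← Finset.sum_add_sum_compl B]
  linarith

end Finite

/-! ### Limits superior and inferior up to a convergent error -/

theorem limsup_le_add_limsup {u v : ℕ → EReal} {e : ℕ → ℝ} {c : ℝ} (he : Tendsto e atTop (𝓝 c))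
    (h : ∀ᶠ n in atTop, u n ≤ (e n : EReal) + v n) :
    limsup u atTop ≤ (c : EReal) + limsup v atTop := by
  have hc : limsup (fun n => (e n : EReal)) atTop = (c : EReal) :=
    (EReal.tendsto_coe.2 he).limsup_eq
  rw [← hc]
  exact (limsup_le_limsup h).trans (EReal.limsup_add_le (Or.inl (by simp [hc]))
    (Or.inl (by simp [hc])))

theorem liminf_le_add_liminf {u v : ℕ → EReal} {e : ℕ → ℝ} {c : ℝ} (he : Tendsto e atTop (𝓝 c))
    (h : ∀ᶠ n in atTop, u n ≤ (e n : EReal) + v n) :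
    liminf u atTop ≤ (c : EReal) + liminf v atTop := by
  have hc : limsup (fun n => (e n : EReal)) atTop = (c : EReal) :=
    (EReal.tendsto_coe.2 he).limsup_eq
  rw [← hc]
  exact (liminf_le_liminf h).trans (EReal.liminf_add_le (Or.inl (by simp [hc]))
    (Or.inl (by simp [hc])))

theorem tendsto_const_mul_inv_natCast (c : ℝ) :
    Tendsto (fun n : ℕ => c * (n : ℝ)⁻¹) atTop (𝓝 0) := by
  simpa using tendsto_inv_atTop_nhds_zero_nat.const_mul c

theorem tendsto_toReal_zero {u : ℕ → ENNReal} (h : Tendsto u atTop (𝓝 0)) :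
    Tendsto (fun n => (u n).toReal) atTop (𝓝 0) := by
  have := (ENNReal.tendsto_toReal ENNReal.zero_ne_top).comp h
  rwa [ENNReal.toReal_zero] at this

theorem le_coe_add_of_sub_le {a b : ℝ} {c : EReal} (h : ((a - b : ℝ) : EReal) ≤ c) :
    (a : EReal) ≤ (b : EReal) + c := by
  calc (a : EReal) = (b : EReal) + ((a - b : ℝ) : EReal) := by
        rw [← EReal.coe_add]; congr 1; ring
    _ ≤ _ := by gcongr

/-! ### General sources -/

theorem nonempty_of_source {A : Type*} (X : Source A) : Nonempty A := by
  obtain ⟨x, -⟩ := (X 1).support_nonempty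
  exact ⟨x 0⟩

section Sources

variable {A : Type*} [Fintype A]

theorem log_card_words (n : ℕ) :
    Real.log (Fintype.card (Fin n → A)) = n * Real.log (Fintype.card A) := by
  simp [Real.log_pow]

theorem sum_filter_toReal {α : Type*} [Fintype α] (P : PMF α) (S : Set α)
    [DecidablePred (· ∈ S)] :
    ∑ x ∈ Finset.univ.filter (· ∈ S), (P x).toReal = (P.toOuterMeasure S).toReal := by
  rw [PMF.toOuterMeasure_apply_fintype, ENNReal.toReal_sum, Finset.sum_filter]
  · refine Finset.sum_congr rfl fun x _ => ?_
    by_cases hx : x ∈ S <;> simp [hx]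
  · intro x _
    by_cases hx : x ∈ S <;> simp [hx, P.apply_ne_top]

theorem normalizedGap_of_ac {Y X : Source A} {n : ℕ} (h : ∀ x, X n x = 0 → Y n x = 0) (ρ : ℝ) :
    normalizedGap Y X ρ n
      = (((n : ℝ)⁻¹ * (ρ * entropy (Y n) - realDivergence (Y n) (X n)) : ℝ) : EReal) := by
  rw [normalizedGap, divergence_of_ac h, ← EReal.coe_sub, ← EReal.coe_mul]

theorem normalizedGap_of_not_ac {Y X : Source A} {n : ℕ} (hn : 0 < n)
    (h : ¬ ∀ x, X n x = 0 → Y n x = 0) (ρ : ℝ) : normalizedGap Y X ρ n = ⊥ := by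
  rw [normalizedGap, divergence_of_not_ac h, sub_eq_add_neg, EReal.neg_top, EReal.add_bot,
    EReal.coe_mul_bot_of_pos]
  positivity

theorem one_le_compressionCost {n : ℕ} (P : PMF (Fin n → A)) {R ρ : ℝ} (hR : 0 ≤ R)
    (hρ : 0 ≤ ρ) (L : (Fin n → A) → ℕ) : 1 ≤ compressionCost P R ρ L := by
  rw [compressionCost, ← sum_toReal_eq_one P]
  refine Finset.sum_le_sum fun x _ => le_mul_of_one_le_right ENNReal.toReal_nonneg ?_
  exact Real.one_le_exp (mul_nonneg hρ (le_min (by positivity) (by positivity)))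

theorem le_compressionExponent {X : Source A} {R ρ r : ℝ} {n : ℕ} (hn : 0 < n)
    (h : ∀ L, IsLengthFunction L → n * r ≤ Real.log (compressionCost (X n) R ρ L)) :
    (r : EReal) ≤ compressionExponent X R ρ n := by
  have hn' : (0 : ℝ) < n := by exact_mod_cast hn
  refine le_iInf₂ fun L hL => EReal.coe_le_coe_iff.2 ?_
  rw [inv_mul_eq_div, le_div_iff₀ hn', mul_comm]
  exact h L hL

theorem compressionExponent_le {X : Source A} {R ρ r : ℝ} {n : ℕ} (hn : 0 < n)
    (h : ∃ L, IsLengthFunction L ∧ Real.log (compressionCost (X n) R ρ L) ≤ n * r) :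
    compressionExponent X R ρ n ≤ (r : EReal) := by
  obtain ⟨L, hL, h⟩ := h
  have hn' : (0 : ℝ) < n := by exact_mod_cast hn
  refine iInf₂_le_of_le L hL (EReal.coe_le_coe_iff.2 ?_)
  rwa [inv_mul_eq_div, div_le_iff₀ hn', mul_comm r]

theorem compressionExponent_nonneg (X : Source A) {R ρ : ℝ} (hR : 0 ≤ R) (hρ : 0 ≤ ρ) (n : ℕ) :
    0 ≤ compressionExponent X R ρ n := by
  refine le_iInf₂ fun L hL => EReal.coe_nonneg.2 ?_
  have := Real.log_nonneg (one_le_compressionCost (X n) hR hρ L)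
  positivity

theorem sum_min_sub_realDivergence_le_log_compressionCost {n : ℕ} {Q P : PMF (Fin n → A)}
    (h : ∀ x, P x = 0 → Q x = 0) (R ρ : ℝ) (L : (Fin n → A) → ℕ) :
    ρ * ∑ x, (Q x).toReal * min ((L x : ℝ) * Real.log 2) (n * R) - realDivergence Q P
      ≤ Real.log (compressionCost P R ρ L) := by
  refine le_trans (le_of_eq ?_) (sum_sub_realDivergence_le_log h _)
  rw [Finset.mul_sum]
  congr 1
  exact Finset.sum_congr rfl fun x _ => by ring

/-! ### The lower bounds -/

/-- The slack `R'` is there because a sup-entropy-rate of at most `R` controls tail probabilities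
only at thresholds above `R`. Lowering the saturation level from `nR'` to `nR` shortens no codeword
by more than `n(R' - R)`. -/
theorem normalizedGap_le_compressionExponent (Y X : Source A) {R R' ρ : ℝ} (hR : 0 < R)
    (hRR' : R ≤ R') (hρ : 0 < ρ) {n : ℕ} (hn : 0 < n) :
    normalizedGap Y X ρ n
      ≤ ((ρ * (3 * (n : ℝ)⁻¹
          + ((Y n).toOuterMeasure {y | R' < selfInformation Y n y}).toReal
            * Real.log (Fintype.card A) + (R' - R)) : ℝ) : EReal)
        + compressionExponent X R ρ n := by
  classical
  have := nonempty_of_source X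
  have hn' : (0 : ℝ) < n := by exact_mod_cast hn
  by_cases hac : ∀ x, X n x = 0 → Y n x = 0
  swap
  · rw [normalizedGap_of_not_ac hn hac]
    exact bot_le
  rw [normalizedGap_of_ac hac]
  refine le_coe_add_of_sub_le (le_compressionExponent hn fun L hL => ?_)
  set S : Set (Fin n → A) := {y | R' < selfInformation Y n y} with hS
  set T : Finset (Fin n → A) := (Finset.univ.filter (· ∈ S))ᶜ with hT
  have h1 := entropy_sub_le_sum_min (Y n) hL (M := n * R')
    (mul_nonneg hn'.le (hR.le.trans hRR')) T (by
      intro x hx hq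
      have hx' : selfInformation Y n x ≤ R' := by simpa [hT, hS] using hx
      have hq' : 0 < (Y n x).toReal := lt_of_le_of_ne ENNReal.toReal_nonneg
        fun h => hq ((toReal_eq_zero_iff _ _).1 h.symm)
      rw [selfInformation, inv_mul_eq_div, div_le_iff₀ hn', one_div, Real.log_inv] at hx'
      rw [← Real.le_log_iff_exp_le hq']
      linarith)
  rw [hT, compl_compl, sum_filter_toReal, log_card_words] at h1
  have h2 : ∑ x, (Y n x).toReal * min ((L x : ℝ) * Real.log 2) (n * R') - n * (R' - R)
      ≤ ∑ x, (Y n x).toReal * min ((L x : ℝ) * Real.log 2) (n * R) := by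
    have : (n : ℝ) * (R' - R) = ∑ x, (Y n x).toReal * (n * (R' - R)) := by
      rw [← Finset.sum_mul, sum_toReal_eq_one, one_mul]
    rw [this, ← Finset.sum_sub_distrib]
    refine Finset.sum_le_sum fun x _ => ?_
    rw [← mul_sub]
    refine mul_le_mul_of_nonneg_left ?_ ENNReal.toReal_nonneg
    have h0 : 0 ≤ (n : ℝ) * (R' - R) := mul_nonneg hn'.le (sub_nonneg.2 hRR')
    refine le_min ?_ ?_
    · linarith [min_le_left ((L x : ℝ) * Real.log 2) (n * R')]
    · linarith [min_le_right ((L x : ℝ) * Real.log 2) (n * R')]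
  have h3 := sum_min_sub_realDivergence_le_log_compressionCost hac R ρ L
  have h4 := mul_le_mul_of_nonneg_left (h1.trans (sub_le_iff_le_add.1 h2)) hρ.le
  have h5 : (n : ℝ) * ((n : ℝ)⁻¹ * (ρ * entropy (Y n) - realDivergence (Y n) (X n))
        - ρ * (3 * (n : ℝ)⁻¹ + ((Y n).toOuterMeasure S).toReal * Real.log (Fintype.card A)
          + (R' - R)))
      = ρ * entropy (Y n) - realDivergence (Y n) (X n)
        - ρ * (3 + ((Y n).toOuterMeasure S).toReal * (n * Real.log (Fintype.card A))
          + n * (R' - R)) := by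
    field_simp
  rw [h5]
  linarith

theorem lowerGap_le_lowerCompressionExponent {Y X : Source A} {R ρ : ℝ} (hR : 0 < R) (hρ : 0 < ρ)
    (hY : supEntropyRate Y ≤ (R : EReal)) : lowerGap Y X ρ ≤ lowerCompressionExponent X R ρ := by
  have key : ∀ R' : ℝ, R < R' →
      lowerGap Y X ρ ≤ ((ρ * (R' - R) : ℝ) : EReal) + lowerCompressionExponent X R ρ := by
    intro R' hRR'
    obtain ⟨θ, hθ, hθR'⟩ : ∃ θ : ℝ, ∃ _ : Tendsto (fun n : ℕ =>
        (Y n).toOuterMeasure {y | θ < selfInformation Y n y}) atTop (𝓝 0),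
        (θ : EReal) < (R' : EReal) :=
      by
      simpa only [supEntropyRate, iInf_lt_iff] using
        hY.trans_lt (EReal.coe_lt_coe_iff.2 hRR')
    have hδ : Tendsto (fun n : ℕ =>
        ((Y n).toOuterMeasure {y | R' < selfInformation Y n y}).toReal) atTop (𝓝 0) := by
      have : Tendsto (fun n : ℕ => (Y n).toOuterMeasure {y | R' < selfInformation Y n y})
          atTop (𝓝 0) := tendsto_of_tendsto_of_tendsto_of_le_of_le tendsto_const_nhds hθ
        (fun _ => zero_le) fun n => MeasureTheory.measure_mono fun y (hy : R' < _) =>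
          (EReal.coe_lt_coe_iff.1 hθR').trans hy
      exact tendsto_toReal_zero this
    refine liminf_le_add_liminf (e := fun n : ℕ => ρ * (3 * (n : ℝ)⁻¹
          + ((Y n).toOuterMeasure {y | R' < selfInformation Y n y}).toReal
            * Real.log (Fintype.card A) + (R' - R))) ?_ ?_
    · have := (((tendsto_const_mul_inv_natCast 3).add
        (hδ.mul_const (Real.log (Fintype.card A)))).add_const (R' - R)).const_mul ρ
      simpa using this
    · filter_upwards [eventually_gt_atTop 0] with n hn
      exact normalizedGap_le_compressionExponent Y X hR hRR'.le hρ hn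
  -- Now `R'` is sent to `R`: it is chosen so that `ρ (R' - R)` fills the gap between `z` and a real
  -- `w` above the compression exponent.
  refine EReal.le_of_forall_lt_iff_le.1 fun z hz => ?_
  obtain ⟨w, hw, hwz⟩ := EReal.lt_iff_exists_real_btwn.1 hz
  have hwz' : 0 < z - w := sub_pos.2 (EReal.coe_lt_coe_iff.1 hwz)
  refine (key (R + (z - w) / ρ) (by linarith [div_pos hwz' hρ])).trans ?_
  have h1 : ρ * (R + (z - w) / ρ - R) = z - w := by field_simp; ring
  rw [h1]
  calc ((z - w : ℝ) : EReal) + lowerCompressionExponent X R ρ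
      ≤ ((z - w : ℝ) : EReal) + (w : EReal) := by gcongr
    _ = (z : EReal) := by rw [← EReal.coe_add]; simp

/-- The additive form avoids subtraction in `EReal`: without absolute continuity the right side is
simply `⊤`. -/
theorem rate_le_compressionExponent_add_divergence (Y X : Source A) {R c ρ : ℝ} (hR : 0 < R)
    (hρ : 0 < ρ) {n : ℕ} (hn : 0 < n) :
    ((ρ * R : ℝ) : EReal)
      ≤ ((ρ * R * (((Y n).toOuterMeasure {y | selfInformation Y n y < c}).toReal
            + Real.exp (n * (R - c))) : ℝ) : EReal)
        + ((((n : ℝ)⁻¹ : ℝ) : EReal) * divergence (Y n) (X n)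
          + compressionExponent X R ρ n) := by
  classical
  have hn' : (0 : ℝ) < n := by exact_mod_cast hn
  have hc0 := compressionExponent_nonneg X hR.le hρ.le n
  by_cases hac : ∀ x, X n x = 0 → Y n x = 0
  swap
  · rw [divergence_of_not_ac hac, EReal.coe_mul_top_of_pos (inv_pos.2 hn'),
      EReal.top_add_of_ne_bot (ne_bot_of_le_ne_bot (by simp) hc0), EReal.coe_add_top]
    exact le_top
  rw [divergence_of_ac hac, ← EReal.coe_mul, ← add_assoc, ← EReal.coe_add]
  refine le_coe_add_of_sub_le (le_compressionExponent hn fun L hL => ?_)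
  set S : Set (Fin n → A) := {y | selfInformation Y n y < c} with hS
  set B : Finset (Fin n → A) := (Finset.univ.filter (· ∈ S))ᶜ with hB
  have h1 := mul_sub_le_sum_min (Y n) hL (M := n * R) (c := n * c)
    (mul_nonneg hn'.le hR.le) B (by
      intro x hx
      have hx' : c ≤ selfInformation Y n x := by simpa [hB, hS] using hx
      rcases eq_or_ne (Y n x).toReal 0 with hq | hq
      · rw [hq]; positivity
      have hq' : 0 < (Y n x).toReal := lt_of_le_of_ne ENNReal.toReal_nonneg hq.symm
      rw [selfInformation, inv_mul_eq_div, le_div_iff₀ hn', one_div, Real.log_inv] at hx'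
      rw [← Real.log_le_iff_le_exp hq']
      linarith)
  rw [hB, compl_compl, sum_filter_toReal, ← mul_sub] at h1
  have h2 := sum_min_sub_realDivergence_le_log_compressionCost hac R ρ L
  have h3 := mul_le_mul_of_nonneg_left h1 hρ.le
  refine le_trans (le_of_eq ?_) ((sub_le_sub_right h3 _).trans h2)
  field_simp
  ring

theorem rate_sub_le_lowerCompressionExponent (X : Source A) {R ρ : ℝ} (hR : 0 < R) (hρ : 0 < ρ) :
    ((ρ * R : ℝ) : EReal)
        - ⨅ (Y : Source A) (_ : (R : EReal) < infEntropyRate Y), upperDivergence Y X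
      ≤ lowerCompressionExponent X R ρ := by
  have hE0 : 0 ≤ lowerCompressionExponent X R ρ :=
    le_liminf_of_le (by isBoundedDefault)
      (Eventually.of_forall fun n => compressionExponent_nonneg X hR.le hρ.le n)
  have key : ∀ Y : Source A, (R : EReal) < infEntropyRate Y →
      ((ρ * R : ℝ) : EReal) ≤ upperDivergence Y X + lowerCompressionExponent X R ρ := by
    intro Y hY
    simp only [infEntropyRate, lt_iSup_iff] at hY
    obtain ⟨c, hc, hRc⟩ := hY
    have hRc' : R < c := EReal.coe_lt_coe_iff.1 hRc
    have hδ : Tendsto (fun n : ℕ =>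
        ((Y n).toOuterMeasure {y | selfInformation Y n y < c}).toReal) atTop (𝓝 0) :=
      tendsto_toReal_zero hc
    have hexp : Tendsto (fun n : ℕ => Real.exp (n * (R - c))) atTop (𝓝 0) :=
      Real.tendsto_exp_atBot.comp
        (tendsto_natCast_atTop_atTop.atTop_mul_const_of_neg (sub_neg.2 hRc'))
    have h0 : Tendsto (fun n : ℕ => ρ * R *
        (((Y n).toOuterMeasure {y | selfInformation Y n y < c}).toReal
          + Real.exp (n * (R - c)))) atTop (𝓝 0) := by
      simpa using (hδ.add hexp).const_mul (ρ * R)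
    have h1 := liminf_le_add_liminf (u := fun _ => ((ρ * R : ℝ) : EReal)) h0
      (by filter_upwards [eventually_gt_atTop 0] with n hn
          exact rate_le_compressionExponent_add_divergence Y X hR hρ hn)
    rw [liminf_const, EReal.coe_zero, zero_add] at h1
    have hD0 : 0 ≤ upperDivergence Y X := by
      refine le_limsup_of_frequently_le (Eventually.frequently ?_) (by isBoundedDefault)
      refine Eventually.of_forall fun n => mul_nonneg (EReal.coe_nonneg.2 (by positivity)) ?_
      by_cases hac : ∀ x, X n x = 0 → Y n x = 0
      · rw [divergence_of_ac hac]
        exact EReal.coe_nonneg.2 (realDivergence_nonneg hac)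
      · rw [divergence_of_not_ac hac]
        exact le_top
    -- The liminf of a sum is at most limsup plus liminf; this is why the upper divergence
    -- accompanies the lower exponent.
    refine h1.trans (EReal.liminf_add_le (Or.inl ?_) (Or.inr ?_))
    · exact ne_bot_of_le_ne_bot (by simp) hD0
    · exact ne_bot_of_le_ne_bot (by simp) hE0
  -- Only a finite exponent can be moved freely across the inequality in `EReal`; `⊥` is excluded by
  -- nonnegativity, and `⊤` is trivial.
  induction h : lowerCompressionExponent X R ρ with
  | bot => simp [h] at hE0
  | top => exact le_top
  | coe e =>
    rw [h] at key
    refine EReal.sub_le_of_le_add' ?_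
    refine EReal.sub_le_iff_le_add (Or.inl (by simp)) (Or.inl (by simp)) |>.1 ?_
    exact le_iInf₂ fun Y hY => EReal.sub_le_of_le_add (key Y hY)

/-! ### The upper bound -/

/-- Sources need not be consistent, so the maximizers for the separate blocklengths together form a
source, which is optimal for all `n > 0` at once. -/
theorem exists_maximal_source (X : Source A) {θ : ℝ} (hθ : 0 ≤ θ) :
    ∃ Y' : Source A, ∀ n : ℕ, 0 < n →
      normalizedGap Y' X θ n
          = (((n : ℝ)⁻¹ * ((1 + θ) * Real.log (tiltedSum (X n) θ)) : ℝ) : EReal) ∧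
        ∀ Y : Source A, normalizedGap Y X θ n ≤ normalizedGap Y' X θ n := by
  choose Y' hac hmax using fun n => exists_tilted (X n) hθ
  refine ⟨Y', fun n hn => ?_⟩
  have h := normalizedGap_of_ac (hac n) θ
  rw [hmax] at h
  refine ⟨h, fun Y => ?_⟩
  by_cases hY : ∀ x, X n x = 0 → Y n x = 0
  · rw [h, normalizedGap_of_ac hY, EReal.coe_le_coe_iff]
    exact mul_le_mul_of_nonneg_left (gap_le_log_tiltedSum hY hθ) (by positivity)
  · rw [normalizedGap_of_not_ac hn hY]
    exact bot_le

theorem exists_upperGap_eq_iSup (X : Source A) {θ : ℝ} (hθ : 0 ≤ θ) :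
    ∃ Y' : Source A, upperGap Y' X θ = ⨆ Y : Source A, upperGap Y X θ := by
  obtain ⟨Y', h⟩ := exists_maximal_source X hθ
  refine ⟨Y', le_antisymm (le_iSup (fun Y => upperGap Y X θ) Y') (iSup_le fun Y => ?_)⟩
  refine limsup_le_limsup ?_
  filter_upwards [eventually_gt_atTop 0] with n hn
  exact (h n hn).2 Y

theorem upperCompressionExponent_le (X : Source A) {R ρ θ : ℝ} (hθ : θ ∈ Set.Icc 0 ρ) :
    upperCompressionExponent X R ρ
      ≤ (((ρ - θ) * R : ℝ) : EReal) + ⨆ Y : Source A, upperGap Y X θ := by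
  have := nonempty_of_source X
  obtain ⟨Y', h⟩ := exists_maximal_source X hθ.1
  refine le_trans ?_ (add_le_add_right (le_iSup (fun Y => upperGap Y X θ) Y') _)
  refine limsup_le_add_limsup
    (e := fun n : ℕ => (ρ - θ) * R + 2 * θ * Real.log 2 * (n : ℝ)⁻¹) ?_ ?_
  · simpa using (tendsto_const_mul_inv_natCast (2 * θ * Real.log 2)).const_add ((ρ - θ) * R)
  · filter_upwards [eventually_gt_atTop 0] with n hn
    have hn' : (0 : ℝ) < n := by exact_mod_cast hn
    rw [(h n hn).1, ← EReal.coe_add]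
    refine compressionExponent_le hn ?_
    obtain ⟨L, hL, hcost⟩ := exists_isLengthFunction_cost_le (X n) (M := n * R) hθ.1 hθ.2
    refine ⟨L, hL, hcost.trans (le_of_eq ?_)⟩
    field_simp
    ring

theorem normalizedGap_mono (Y X : Source A) {θ θ' : ℝ} (h : θ ≤ θ') {n : ℕ} (hn : 0 < n) :
    normalizedGap Y X θ n ≤ normalizedGap Y X θ' n := by
  by_cases hY : ∀ x, X n x = 0 → Y n x = 0
  · rw [normalizedGap_of_ac hY, normalizedGap_of_ac hY, EReal.coe_le_coe_iff]
    have := entropy_nonneg (Y n)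
    gcongr
  · rw [normalizedGap_of_not_ac hn hY]
    exact bot_le

/-- Only the entropy is multiplied by `θ`, and it is at most `n log |A|`. The Lipschitz constant is
thus uniform in `Y` and `n` and survives the limsup and the supremum. -/
theorem normalizedGap_le_add (Y X : Source A) {θ θ' : ℝ} (h : θ ≤ θ') {n : ℕ} (hn : 0 < n) :
    normalizedGap Y X θ' n
      ≤ (((θ' - θ) * Real.log (Fintype.card A) : ℝ) : EReal) + normalizedGap Y X θ n := by
  have := nonempty_of_source X
  have hn' : (0 : ℝ) < n := by exact_mod_cast hn
  by_cases hY : ∀ x, X n x = 0 → Y n x = 0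
  · rw [normalizedGap_of_ac hY, normalizedGap_of_ac hY, ← EReal.coe_add, EReal.coe_le_coe_iff]
    have h1 := entropy_le_log_card (Y n)
    rw [log_card_words] at h1
    have h2 := mul_le_mul_of_nonneg_left h1 (sub_nonneg.2 h)
    rw [inv_mul_eq_div, inv_mul_eq_div, ← sub_le_iff_le_add, ← sub_div, div_le_iff₀ hn']
    linarith
  · rw [normalizedGap_of_not_ac hn hY]
    exact bot_le

/-- The minimum over `θ` is attained, since the function to minimize is continuous. -/
theorem exists_minimizing_tilt (X : Source A) (R : ℝ) {ρ : ℝ} (hρ : 0 ≤ ρ) :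
    ∃ θ' ∈ Set.Icc (0 : ℝ) ρ,
      (((ρ - θ') * R : ℝ) : EReal) + (⨆ Y : Source A, upperGap Y X θ')
        = ⨅ θ ∈ Set.Icc (0 : ℝ) ρ,
            ((((ρ - θ) * R : ℝ) : EReal) + ⨆ Y : Source A, upperGap Y X θ) := by
  have := nonempty_of_source X
  set c : ℝ := Real.log (Fintype.card A) with hc
  have hc0 : 0 ≤ c := Real.log_natCast_nonneg _
  set h : ℝ → EReal := fun θ => ⨆ Y : Source A, upperGap Y X θ with hh
  have hmono : ∀ θ θ' : ℝ, θ ≤ θ' → h θ ≤ h θ' := fun θ θ' hle => iSup_mono fun Y =>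
    limsup_le_limsup (by
      filter_upwards [eventually_gt_atTop 0] with n hn using normalizedGap_mono Y X hle hn)
  have hlip : ∀ θ θ' : ℝ, θ ≤ θ' → h θ' ≤ (((θ' - θ) * c : ℝ) : EReal) + h θ :=
    fun θ θ' hle => iSup_le fun Y => (limsup_le_add_limsup tendsto_const_nhds (by
      filter_upwards [eventually_gt_atTop 0] with n hn using
        normalizedGap_le_add Y X hle hn)).trans
      (add_le_add_right (le_iSup (fun Y => upperGap Y X θ) Y) _)
  -- At `θ = 0` the best choice is `Y = X`. With monotonicity and the Lipschitz bound this makes `h`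
  -- finite on the whole interval, so that real-valued compactness arguments apply.
  have h0 : h 0 = 0 := by
    refine le_antisymm (iSup_le fun Y => ?_) ?_
    · refine (limsup_le_limsup (v := fun _ => (0 : EReal)) ?_).trans_eq (limsup_const _)
      filter_upwards [eventually_gt_atTop 0] with n hn
      by_cases hY : ∀ x, X n x = 0 → Y n x = 0
      · rw [normalizedGap_of_ac hY, ← EReal.coe_zero, EReal.coe_le_coe_iff]
        have := realDivergence_nonneg hY
        exact mul_nonpos_of_nonneg_of_nonpos (by positivity) (by linarith)
      · rw [normalizedGap_of_not_ac hn hY]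
        exact bot_le
    · refine le_trans ?_ (le_iSup (fun Y => upperGap Y X 0) X)
      refine le_limsup_of_frequently_le (Eventually.frequently (Eventually.of_forall fun n => ?_))
        (by isBoundedDefault)
      rw [normalizedGap_of_ac fun _ h => h, realDivergence_self]
      simp
  have hreal : ∀ θ ∈ Set.Icc (0 : ℝ) ρ, ((h θ).toReal : EReal) = h θ := by
    intro θ hθ
    refine EReal.coe_toReal (ne_top_of_le_ne_top ?_ (hlip 0 θ hθ.1))
      (ne_bot_of_le_ne_bot ?_ (hmono 0 θ hθ.1))
    · rw [h0, add_zero]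
      exact EReal.coe_ne_top _
    · simp [h0]
  have hcont : ContinuousOn (fun θ => (h θ).toReal) (Set.Icc 0 ρ) := by
    refine (LipschitzOnWith.of_le_add_mul ⟨c, hc0⟩ fun θ hθ θ' hθ' => ?_).continuousOn
    rw [← EReal.coe_le_coe_iff, hreal θ hθ, add_comm, EReal.coe_add, hreal θ' hθ']
    rcases le_total θ θ' with hle | hle
    · exact (hmono θ θ' hle).trans (le_add_of_nonneg_left
        (EReal.coe_nonneg.2 (mul_nonneg hc0 dist_nonneg)))
    · refine (hlip θ' θ hle).trans_eq ?_
      rw [Real.dist_eq, abs_of_nonneg (sub_nonneg.2 hle), mul_comm]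
      rfl
  obtain ⟨θ', hθ', hmin⟩ := isCompact_Icc.exists_isMinOn (Set.nonempty_Icc.2 hρ)
    (f := fun θ => (ρ - θ) * R + (h θ).toReal) (by fun_prop)
  refine ⟨θ', hθ', le_antisymm (le_iInf₂ fun θ hθ => ?_) (iInf₂_le θ' hθ')⟩
  change _ + h θ' ≤ _ + h θ
  rw [← hreal θ hθ, ← hreal θ' hθ', ← EReal.coe_add, ← EReal.coe_add, EReal.coe_le_coe_iff]
  exact hmin hθ

end Sources

/-! ### Orderings of a finite set -/

section Orderings

variable {α β : Type*} [Fintype α] [LinearOrder β]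

theorem exists_equiv_fin_monotone (v : α → β) :
    ∃ e : α ≃ Fin (Fintype.card α), ∀ x x', e x ≤ e x' → v x ≤ v x' := by
  let e₀ := Fintype.equivFin α
  refine ⟨e₀.trans (Tuple.sort (v ∘ e₀.symm)).symm, fun x x' h => ?_⟩
  simpa using Tuple.monotone_sort (v ∘ e₀.symm) h

/-- Ties are broken arbitrarily, so a rank is only bracketed: this bound counts ties, and
`card_le_rank` does not. -/
theorem rank_add_one_le_card {v : α → β} {e : α ≃ Fin (Fintype.card α)}
    (he : ∀ x x', e x ≤ e x' → v x ≤ v x') (x : α) :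
    (e x : ℕ) + 1 ≤ (Finset.univ.filter fun x' => v x' ≤ v x).card := by
  rw [← Fin.card_Iic, ← Finset.card_map e.symm.toEmbedding]
  refine Finset.card_le_card fun z hz => ?_
  obtain ⟨i, hi, rfl⟩ := Finset.mem_map.1 hz
  exact Finset.mem_filter.2 ⟨Finset.mem_univ _, he _ _ (by simpa using hi)⟩

theorem card_le_rank {v : α → β} {e : α ≃ Fin (Fintype.card α)}
    (he : ∀ x x', e x ≤ e x' → v x ≤ v x') (x : α) :
    (Finset.univ.filter fun x' => v x' < v x).card ≤ e x := by
  rw [← Fin.card_Iio, ← Finset.card_map e.toEmbedding]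
  refine Finset.card_le_card fun z hz => ?_
  obtain ⟨x', hx', rfl⟩ := Finset.mem_map.1 hz
  rw [Finset.mem_Iio]
  by_contra h
  exact absurd (he _ _ (not_lt.1 h)) (not_le.2 (Finset.mem_filter.1 hx').2)

end Orderings

/-! ### Guessing strategies -/

theorem jointProb_nonneg {α : Type*} {k : ℕ} (P : PMF α) (f : α → (Fin k → Bool) → List Bool)
    (x : α) (y : List Bool) :
    0 ≤ jointProb P f x y := by
  rw [jointProb]; positivity

section Guessing

variable {α : Type*} [Fintype α] {k : ℕ}

/-- For a cryptogram of probability zero all posteriors are `0` by convention, but then all joint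
probabilities vanish as well. -/
theorem jointProb_le_of_posterior_le {P : PMF α} {f : α → (Fin k → Bool) → List Bool} {x x' : α}
    {y : List Bool} (h : posterior P f x' y ≤ posterior P f x y) :
    jointProb P f x' y ≤ jointProb P f x y := by
  have h0 : 0 ≤ ∑ z, jointProb P f z y := Finset.sum_nonneg fun z _ => jointProb_nonneg P f z y
  rcases h0.eq_or_lt with h1 | h1
  · have h2 := (Finset.sum_eq_zero_iff_of_nonneg fun z _ => jointProb_nonneg P f z y).1 h1.symm
    rw [h2 x' (Finset.mem_univ _), h2 x (Finset.mem_univ _)]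
  · exact (div_le_div_iff_of_pos_right h1).1 h

/-- Grouping by cryptogram allows strategies to be compared one cryptogram at a time. -/
theorem guessingMoment_eq_sum_jointProb (P : PMF α) (f : α → (Fin k → Bool) → List Bool)
    (G : GuessingStrategy α) (ρ : ℝ) :
    guessingMoment P f G ρ
      = ∑ y ∈ Finset.univ.image fun z : α × (Fin k → Bool) => f z.1 z.2,
          ∑ x, jointProb P f x y * (((G y x : ℕ) : ℝ) + 1) ^ ρ := by
  refine Eq.trans ?_ Finset.sum_comm
  refine Finset.sum_congr rfl fun x _ => ?_
  rw [← Finset.sum_fiberwise_of_maps_to (s := Finset.univ) (g := fun u => f x u)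
    (t := Finset.univ.image fun z : α × (Fin k → Bool) => f z.1 z.2)
    fun u _ => Finset.mem_image.2 ⟨(x, u), Finset.mem_univ _, rfl⟩]
  refine Finset.sum_congr rfl fun y _ => ?_
  have h : ∀ u ∈ Finset.univ.filter (fun u => f x u = y),
      (P x).toReal * (1 / 2 ^ k) * (((G (f x u) x : ℕ) : ℝ) + 1) ^ ρ
        = (P x).toReal * (1 / 2 ^ k) * (((G y x : ℕ) : ℝ) + 1) ^ ρ := fun u hu => by
    rw [(Finset.mem_filter.1 hu).2]
  rw [Finset.sum_congr rfl h, Finset.sum_const, nsmul_eq_mul, jointProb]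
  ring

/-- Guessing in decreasing order of the posterior probabilities is optimal. -/
theorem IsOptimalAttack.guessingMoment_le {P : PMF α} {f : α → (Fin k → Bool) → List Bool}
    {G : GuessingStrategy α} (hG : IsOptimalAttack P f G) (G' : GuessingStrategy α) {ρ : ℝ}
    (hρ : 0 < ρ) : guessingMoment P f G ρ ≤ guessingMoment P f G' ρ := by
  rw [guessingMoment_eq_sum_jointProb, guessingMoment_eq_sum_jointProb]
  refine Finset.sum_le_sum fun y _ => ?_
  have hav : Antivary (fun x => jointProb P f x y) fun x => (((G y x : ℕ) : ℝ) + 1) ^ ρ := by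
    intro x x' h
    have h1 := (Real.rpow_lt_rpow_iff (by positivity) (by positivity) hρ).1 h
    exact jointProb_le_of_posterior_le (hG y x x' (Fin.lt_def.2 (by
      exact_mod_cast lt_of_add_lt_add_right h1)))
  -- Rearrangement inequality: the permutation turns the order `G y` into `G' y`.
  have h2 := hav.sum_mul_le_sum_mul_comp_perm (σ := (G' y).trans (G y).symm)
  simpa using h2

theorem sum_key_eq (c : ℝ) : ∑ _u : Fin k → Bool, c * (1 / 2 ^ k) = c := by
  rw [Finset.sum_const, nsmul_eq_mul]
  simp only [Finset.card_univ, Fintype.card_pi_const, Fintype.card_bool, Nat.cast_pow,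
    Nat.cast_ofNat]
  field_simp

theorem one_le_guessingMoment (P : PMF α) (f : α → (Fin k → Bool) → List Bool)
    (G : GuessingStrategy α) {ρ : ℝ} (hρ : 0 ≤ ρ) : 1 ≤ guessingMoment P f G ρ := by
  refine (sum_toReal_eq_one P).ge.trans ?_
  refine Finset.sum_le_sum fun x _ => ?_
  refine (sum_key_eq (k := k) (P x).toReal).ge.trans ?_
  refine Finset.sum_le_sum fun u _ => le_mul_of_one_le_right ?_
    (Real.one_le_rpow ?_ hρ)
  · positivity
  · simp

/-- Pick for each possible decryption a key producing `y`; two messages cannot share a key. -/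
theorem IsEncryption.card_decryptions_le {f : α → (Fin k → Bool) → List Bool}
    (hf : IsEncryption f) (y : List Bool) [DecidablePred fun x => ∃ u, f x u = y] :
    (Finset.univ.filter fun x => ∃ u, f x u = y).card ≤ 2 ^ k := by
  classical
  have h : Fintype.card (Fin k → Bool) = 2 ^ k := by simp
  rw [← h, ← Finset.card_univ]
  choose! g hg using fun (x : α) (hx : ∃ u, f x u = y) => hx
  refine Finset.card_le_card_of_injOn g (fun _ _ => Finset.mem_univ _) fun x hx x' hx' hxx' => ?_
  have h1 := hg x (by simpa using hx)
  have h2 := hg x' (by simpa using hx')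
  exact hf (g x) (h1.trans (hxx' ▸ h2.symm))

/-- An attacker who interleaves guessing in order of increasing codeword length with guessing all
decryptions of the cryptogram. -/
theorem exists_guessingStrategy_le {f : α → (Fin k → Bool) → List Bool} (hf : IsEncryption f)
    {L : α → ℕ} (hL : IsLengthFunction L) :
    ∃ G : GuessingStrategy α, ∀ x u, (G (f x u) x : ℕ) + 1 ≤ 2 * 2 ^ min (L x) k := by
  classical
  -- Decryptions of `y` are treated as if their codewords had at most `k` bits, and messages are
  -- guessed by increasing modified length.
  choose G hG using fun y : List Bool => exists_equiv_fin_monotone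
    fun x => if ∃ u, f x u = y then min (L x) k else L x
  refine ⟨G, fun x u => (rank_add_one_le_card (hG (f x u)) x).trans ?_⟩
  have hx : ∃ u', f x u' = f x u := ⟨u, rfl⟩
  simp only [if_pos hx]
  rcases lt_or_ge (L x) k with h | h
  · rw [min_eq_left h.le]
    refine (Finset.card_le_card fun z hz => ?_).trans
      ((card_filter_le_of_isLengthFunction hL (L x)).trans (by omega))
    have hz' := (Finset.mem_filter.1 hz).2
    refine Finset.mem_filter.2 ⟨Finset.mem_univ _, ?_⟩
    split_ifs at hz' <;> omega
  -- Anything guessed no later than `x` has a codeword of at most `k` bits or is a decryption; there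
  -- are at most `2^k` of each kind.
  · rw [min_eq_right h, two_mul]
    refine (Finset.card_le_card
      (t := (Finset.univ.filter fun z => L z ≤ k)
        ∪ Finset.univ.filter fun z => ∃ u', f z u' = f x u) fun z hz => ?_).trans
      ((Finset.card_union_le _ _).trans
        (add_le_add (card_filter_le_of_isLengthFunction hL k) (hf.card_decryptions_le _)))
    have hz' := (Finset.mem_filter.1 hz).2
    rw [Finset.mem_union, Finset.mem_filter, Finset.mem_filter]
    split_ifs at hz' with h'
    · exact Or.inr ⟨Finset.mem_univ _, h'⟩
    · exact Or.inl ⟨Finset.mem_univ _, hz'⟩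

/-- Of the constant `4`, one factor `2` comes from interleaving two lists of guesses and the other
from rounding the key length up. -/
theorem IsOptimalAttack.guessingMoment_le_cost {P : PMF α}
    {f : α → (Fin k → Bool) → List Bool} (hf : IsEncryption f) {G : GuessingStrategy α}
    (hG : IsOptimalAttack P f G) {L : α → ℕ} (hL : IsLengthFunction L) {ρ M : ℝ} (hρ : 0 < ρ)
    (hk : (k : ℝ) * Real.log 2 ≤ M + Real.log 2) :
    guessingMoment P f G ρ
      ≤ (4 : ℝ) ^ ρ * ∑ x, (P x).toReal * Real.exp (ρ * min ((L x : ℝ) * Real.log 2) M) := by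
  obtain ⟨G', hG'⟩ := exists_guessingStrategy_le hf hL
  refine (hG.guessingMoment_le G' hρ).trans ?_
  rw [guessingMoment, Finset.mul_sum]
  refine Finset.sum_le_sum fun x _ => ?_
  rw [← sum_key_eq (k := k) ((4 : ℝ) ^ ρ * _)]
  refine Finset.sum_le_sum fun u _ => ?_
  have hl2 : 0 < Real.log 2 := Real.log_pos one_lt_two
  have h1 : ((G' (f x u) x : ℕ) : ℝ) + 1 ≤ 4 * Real.exp (min ((L x : ℝ) * Real.log 2) M) := by
    have h2 : ((G' (f x u) x : ℕ) : ℝ) + 1 ≤ 2 * 2 ^ min (L x) k := by exact_mod_cast hG' x u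
    have h3 : (2 : ℝ) ^ min (L x) k = Real.exp (((min (L x) k : ℕ) : ℝ) * Real.log 2) := by
      rw [Real.exp_nat_mul, Real.exp_log two_pos]
    have h4 : ((min (L x) k : ℕ) : ℝ) * Real.log 2
        ≤ Real.log 2 + min ((L x : ℝ) * Real.log 2) M := by
      rw [← min_add_add_left]
      refine le_min ?_ ?_
      · have : ((min (L x) k : ℕ) : ℝ) ≤ L x := by exact_mod_cast min_le_left _ _
        nlinarith
      · have : ((min (L x) k : ℕ) : ℝ) ≤ k := by exact_mod_cast min_le_right _ _
        nlinarith
    have h5 := Real.exp_le_exp.2 h4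
    rw [Real.exp_add, Real.exp_log two_pos, ← h3] at h5
    linarith
  have h6 : (((G' (f x u) x : ℕ) : ℝ) + 1) ^ ρ
      ≤ (4 : ℝ) ^ ρ * Real.exp (ρ * min ((L x : ℝ) * Real.log 2) M) := by
    refine (Real.rpow_le_rpow (by positivity) h1 hρ.le).trans_eq ?_
    rw [Real.mul_rpow (by norm_num) (Real.exp_pos _).le, ← Real.exp_mul, mul_comm ρ]
  calc (P x).toReal * (1 / 2 ^ k) * (((G' (f x u) x : ℕ) : ℝ) + 1) ^ ρ
      ≤ (P x).toReal * (1 / 2 ^ k)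
        * ((4 : ℝ) ^ ρ * Real.exp (ρ * min ((L x : ℝ) * Real.log 2) M)) := by gcongr
    _ = _ := by ring

/-! ### An encryption function that is hard to break -/

/-- Encryption by a one-time pad inside of blocks of `2 ^ k` consecutive messages, for an
enumeration of the messages by decreasing probability. -/
theorem exists_encryption_le_guessingMoment (P : PMF α) (k : ℕ) :
    ∃ e : α ≃ Fin (Fintype.card α),
      (∀ x x', e x ≤ e x' → (P x').toReal ≤ (P x).toReal) ∧
      ∃ (f : α → (Fin k → Bool) → List Bool) (G : GuessingStrategy α),
        IsEncryption f ∧ IsOptimalAttack P f G ∧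
        ∀ x u, (e x : ℕ) % 2 ^ k ≤ G (f x u) x := by
  classical
  obtain ⟨e, he⟩ := exists_equiv_fin_monotone fun x => -(P x).toReal
  have heP : ∀ x x', e x ≤ e x' → (P x').toReal ≤ (P x).toReal := fun x x' h =>
    neg_le_neg_iff.1 (he x x' h)
  refine ⟨e, heP, ?_⟩
  set K := 2 ^ k with hK
  have hK0 : 0 < K := by positivity
  let c : (Fin k → Bool) ≃ Fin K := Fintype.equivFinOfCardEq (by simp [hK])
  -- Block number and shifted position are written in unary: the length of a cryptogram is
  -- irrelevant, so any injection into strings will do.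
  let f : α → (Fin k → Bool) → List Bool := fun x u =>
    List.replicate (Nat.pair ((e x : ℕ) / K) (((e x : ℕ) % K + c u) % K)) true
  have hfeq : ∀ x u x' u', f x u = f x' u' ↔ (e x : ℕ) / K = (e x' : ℕ) / K ∧
      ((e x : ℕ) % K + c u) % K = ((e x' : ℕ) % K + c u') % K := by
    intro x u x' u'
    rw [← Nat.pair_eq_pair]
    exact (List.replicate_left_injective true).eq_iff
  have hf : IsEncryption f := by
    intro u x x' h
    obtain ⟨h1, h2⟩ := (hfeq x u x' u).1 h
    have h3 : (e x : ℕ) % K % K = (e x' : ℕ) % K % K := Nat.ModEq.add_right_cancel' _ h2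
    rw [Nat.mod_mod, Nat.mod_mod] at h3
    refine e.injective (Fin.ext ?_)
    rw [← Nat.div_add_mod (e x : ℕ) K, h1, h3, Nat.div_add_mod]
  have hkey : ∀ x, Function.Injective (f x) := by
    intro x u u' h
    have h2 : (c u : ℕ) % K = (c u' : ℕ) % K := Nat.ModEq.add_left_cancel' _ ((hfeq x u x u').1 h).2
    rw [Nat.mod_eq_of_lt (c u).2, Nat.mod_eq_of_lt (c u').2] at h2
    exact c.injective (Fin.ext h2)
  have hblock : ∀ x u x', (∃ u', f x' u' = f x u) ↔ (e x' : ℕ) / K = (e x : ℕ) / K := by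
    intro x u x'
    refine ⟨fun ⟨u', h⟩ => ((hfeq _ _ _ _).1 h).1, fun h => ?_⟩
    have hr : ((e x : ℕ) % K + c u + (K - (e x' : ℕ) % K)) % K < K := Nat.mod_lt _ hK0
    refine ⟨c.symm ⟨_, hr⟩, (hfeq _ _ _ _).2 ⟨h, ?_⟩⟩
    rw [Equiv.apply_symm_apply]
    simp only [Nat.add_mod_mod]
    have h1 : (e x' : ℕ) % K ≤ K := (Nat.mod_lt _ hK0).le
    have h2 : (e x' : ℕ) % K + ((e x : ℕ) % K + c u + (K - (e x' : ℕ) % K))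
        = (e x : ℕ) % K + c u + K := by omega
    rw [h2, Nat.add_mod_right]
  -- Each message of the block reaches `y` under exactly one key, so the posterior on the block is
  -- proportional to `P`.
  have hjoint : ∀ x y, jointProb P f x y
      = if ∃ u, f x u = y then (P x).toReal * (1 / 2 ^ k) else 0 := by
    intro x y
    rw [jointProb]
    split_ifs with h
    · obtain ⟨u, rfl⟩ := h
      have : (Finset.univ.filter fun u' => f x u' = f x u) = {u} := by
        ext u'
        simp [(hkey x).eq_iff]
      rw [this]
      simp
    · have : (Finset.univ.filter fun u' => f x u' = y) = ∅ := by
        ext u'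
        simpa using fun h' => h ⟨u', h'⟩
      rw [this]
      simp
  -- The block is guessed in the order of `e`; the offset `Fintype.card α` puts all other messages
  -- after it.
  choose G hG using fun y : List Bool => exists_equiv_fin_monotone
    fun x => if ∃ u, f x u = y then (e x : ℕ) else Fintype.card α + e x
  refine ⟨f, G, hf, fun y x x' h => ?_, fun x u => ?_⟩
  · refine div_le_div_of_nonneg_right ?_ (Finset.sum_nonneg fun z _ => jointProb_nonneg P f z y)
    have hv := hG y x x' h.le
    rw [hjoint x']
    split_ifs with hx'
    · simp only [if_pos hx'] at hv
      have hx : ∃ u, f x u = y := by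
        by_contra hx
        rw [if_neg hx] at hv
        have := (e x').2
        omega
      rw [if_pos hx] at hv
      rw [hjoint, if_pos hx]
      exact mul_le_mul_of_nonneg_right (heP x x' hv) (by positivity)
    · exact jointProb_nonneg P f x y
  · refine le_trans ?_ (card_le_rank (hG (f x u)) x)
    have hx : ∃ u', f x u' = f x u := ⟨u, rfl⟩
    -- These are the predecessors of `x` in its block, all guessed before `x`.
    have hlt : ∀ j ∈ Finset.range ((e x : ℕ) % K),
        (e x : ℕ) / K * K + j < Fintype.card α := fun j hj => by
      have h1 := Nat.div_add_mod' (e x : ℕ) K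
      have h2 := (e x).2
      have h3 := Finset.mem_range.1 hj
      omega
    rw [← Finset.card_range ((e x : ℕ) % K), ← Finset.card_attach]
    refine Finset.card_le_card_of_injOn (fun j => e.symm ⟨_, hlt j.1 j.2⟩)
      (fun j _ => ?_) fun j _ j' _ h => ?_
    · have h3 := Finset.mem_range.1 j.2
      have hjK : j.1 < K := h3.trans (Nat.mod_lt _ hK0)
      have hz : ∃ u', f (e.symm ⟨_, hlt j.1 j.2⟩) u' = f x u := by
        rw [hblock, Equiv.apply_symm_apply]
        simp only [mul_comm _ K, Nat.mul_add_div hK0, Nat.div_eq_of_lt hjK, add_zero]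
      have h1 := Nat.div_add_mod' (e x : ℕ) K
      simp only [Finset.coe_filter, Set.mem_ofPred_eq, Finset.mem_univ, true_and, if_pos hx,
        if_pos hz, Equiv.apply_symm_apply]
      omega
    · have h1 := Fin.mk.inj_iff.1 (e.symm.injective h)
      exact Subtype.ext (by omega)

/-! ### Saturated moments versus moments restarting in each block -/

/-- A discrete form of `∫₀ᴷ t^ρ dt = K^(ρ+1)/(ρ+1)`. The induction step is Bernoulli's inequality at
`-1/(K+1)`. -/
theorem rpow_le_sum_rpow {ρ : ℝ} (hρ : 0 ≤ ρ) (K : ℕ) :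
    (K : ℝ) ^ (ρ + 1) ≤ (ρ + 1) * ∑ j ∈ Finset.range K, ((j : ℝ) + 1) ^ ρ := by
  induction K with
  | zero => simp [Real.zero_rpow (by linarith : ρ + 1 ≠ 0)]
  | succ K ih =>
    rw [Finset.sum_range_succ, mul_add]
    have hK : (0 : ℝ) < (K : ℝ) + 1 := by positivity
    have h1 := one_add_mul_self_le_rpow_one_add (s := -((K : ℝ) + 1)⁻¹) (p := ρ + 1)
      (by rw [neg_le_neg_iff]; exact inv_le_one_of_one_le₀ (by simp)) (by linarith)
    have h2 : ((K : ℝ) + 1) * (1 + -((K : ℝ) + 1)⁻¹) = K := by field_simp; ring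
    have h3 : 0 ≤ 1 + -((K : ℝ) + 1)⁻¹ := by
      rw [← sub_eq_add_neg, sub_nonneg]
      exact inv_le_one_of_one_le₀ (by simp)
    have h4 := mul_le_mul_of_nonneg_left h1 (Real.rpow_nonneg hK.le (ρ + 1))
    rw [← Real.mul_rpow hK.le h3, h2] at h4
    have h5 : ((K : ℝ) + 1) ^ (ρ + 1) * (1 + (ρ + 1) * -((K : ℝ) + 1)⁻¹)
        = ((K : ℝ) + 1) ^ (ρ + 1) - (ρ + 1) * ((K : ℝ) + 1) ^ ρ := by
      rw [Real.rpow_add_one hK.ne']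
      field_simp
      ring
    push_cast
    linarith

/-- For nonincreasing weights, starting to count anew after each block of `K` does not decrease
saturated moments by more than a constant factor. -/
theorem sum_min_rpow_le_sum_mod_rpow {p : ℕ → ℝ} (hp : Antitone p) (h0 : ∀ i, 0 ≤ p i) {ρ : ℝ}
    (hρ : 0 ≤ ρ) {K : ℕ} (hK : 0 < K) (B : ℕ) :
    ∑ i ∈ Finset.range (B * K), p i * (min ((i : ℝ) + 1) K) ^ ρ
      ≤ (ρ + 2) * ∑ i ∈ Finset.range (B * K), p i * (((i % K : ℕ) : ℝ) + 1) ^ ρ := by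
  set s : ℕ → ℝ := fun i => p i * (min ((i : ℝ) + 1) K) ^ ρ with hs
  set t : ℕ → ℝ := fun i => p i * (((i % K : ℕ) : ℝ) + 1) ^ ρ with ht
  have ht0 : ∀ i, 0 ≤ t i := fun i => mul_nonneg (h0 i) (by positivity)
  have hsplit : ∀ (g : ℕ → ℝ) (b : ℕ), ∑ i ∈ Finset.range ((b + 1) * K), g i
      = ∑ i ∈ Finset.range (b * K), g i + ∑ j ∈ Finset.range K, g (b * K + j) := fun g b => by
    rw [add_mul, one_mul, Finset.sum_range_add]
  have hmod : ∀ b, ∀ j ∈ Finset.range K, (b * K + j) % K = j := fun b j hj => by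
    rw [Nat.mul_add_mod_self_right, Nat.mod_eq_of_lt (Finset.mem_range.1 hj)]
  -- The saturated sum over a block is charged to the preceding block, where every weight is at
  -- least `p ((b + 1) * K)`.
  have hblock : ∀ b, ∑ j ∈ Finset.range K, s ((b + 1) * K + j)
      ≤ (ρ + 1) * ∑ j ∈ Finset.range K, t (b * K + j) := by
    intro b
    have h1 : ∑ j ∈ Finset.range K, s ((b + 1) * K + j)
        ≤ ∑ j ∈ Finset.range K, p ((b + 1) * K) * (K : ℝ) ^ ρ := by
      refine Finset.sum_le_sum fun j _ => ?_
      refine mul_le_mul (hp (Nat.le_add_right _ _)) ?_ (by positivity) (h0 _)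
      exact Real.rpow_le_rpow (by positivity) (min_le_right _ _) hρ
    rw [Finset.sum_const, Finset.card_range, nsmul_eq_mul] at h1
    have h2 : p ((b + 1) * K) * ∑ j ∈ Finset.range K, ((j : ℝ) + 1) ^ ρ
        ≤ ∑ j ∈ Finset.range K, t (b * K + j) := by
      rw [Finset.mul_sum]
      refine Finset.sum_le_sum fun j hj => ?_
      simp only [ht, hmod b j hj]
      refine mul_le_mul_of_nonneg_right (hp ?_) (by positivity)
      have := Finset.mem_range.1 hj
      rw [add_mul]
      omega
    have h3 := mul_le_mul_of_nonneg_left (rpow_le_sum_rpow hρ K) (h0 ((b + 1) * K))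
    rw [Real.rpow_add_one (by positivity)] at h3
    have h4 := mul_le_mul_of_nonneg_left h2 (by linarith : 0 ≤ ρ + 1)
    linarith
  -- The first block has no predecessor but needs no factor, which gives `1 + (ρ + 1)` in total.
  have key : ∀ b, ∑ i ∈ Finset.range ((b + 1) * K), s i
      ≤ ∑ i ∈ Finset.range ((b + 1) * K), t i
        + (ρ + 1) * ∑ i ∈ Finset.range (b * K), t i := by
    intro b
    induction b with
    | zero =>
      simp only [zero_add, one_mul, zero_mul, Finset.range_zero, Finset.sum_empty, mul_zero,
        add_zero]
      refine Finset.sum_le_sum fun i hi => ?_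
      have hi' := Finset.mem_range.1 hi
      simp only [hs, ht, Nat.mod_eq_of_lt hi']
      refine mul_le_mul_of_nonneg_left ?_ (h0 i)
      exact Real.rpow_le_rpow (by positivity) (min_le_left _ _) hρ
    | succ b ih =>
      rw [hsplit s (b + 1), hsplit t (b + 1)]
      have h1 := hblock b
      have h2 := hsplit t b
      have h3 : 0 ≤ ∑ j ∈ Finset.range K, t ((b + 1) * K + j) := Finset.sum_nonneg fun _ _ => ht0 _
      have h4 : (ρ + 1) * ∑ i ∈ Finset.range ((b + 1) * K), t i
          = (ρ + 1) * ∑ i ∈ Finset.range (b * K), t i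
            + (ρ + 1) * ∑ j ∈ Finset.range K, t (b * K + j) := by rw [h2]; ring
      linarith
  cases B with
  | zero => simp
  | succ b =>
    have h1 : ∑ i ∈ Finset.range (b * K), t i ≤ ∑ i ∈ Finset.range ((b + 1) * K), t i :=
      Finset.sum_le_sum_of_subset_of_nonneg
        (Finset.range_mono (Nat.mul_le_mul_right K (Nat.le_succ b))) fun _ _ _ => ht0 _
    have h2 := mul_le_mul_of_nonneg_left h1 (by linarith : 0 ≤ ρ + 1)
    linarith [key b]

theorem sum_min_rank_rpow_le (P : PMF α) {e : α ≃ Fin (Fintype.card α)}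
    (he : ∀ x x', e x ≤ e x' → (P x').toReal ≤ (P x).toReal) {ρ : ℝ} (hρ : 0 ≤ ρ) {K : ℕ}
    (hK : 0 < K) :
    ∑ x, (P x).toReal * (min (((e x : ℕ) : ℝ) + 1) K) ^ ρ
      ≤ (ρ + 2) * ∑ x, (P x).toReal * ((((e x : ℕ) % K : ℕ) : ℝ) + 1) ^ ρ := by
  -- Extension by zero keeps the weights decreasing and fills up the last block.
  set p : ℕ → ℝ := fun i => if h : i < Fintype.card α then (P (e.symm ⟨i, h⟩)).toReal else 0 with hp
  have hp0 : ∀ i, 0 ≤ p i := fun i => by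
    simp only [hp]; split_ifs <;> positivity
  have hpanti : Antitone p := by
    intro i j hij
    by_cases hj : j < Fintype.card α
    · simp only [hp, dif_pos hj, dif_pos (hij.trans_lt hj)]
      exact he _ _ (by simpa using hij)
    · simp only [hp, dif_neg hj]
      exact hp0 i
  have hsum : ∀ F : ℕ → ℝ, ∑ x, (P x).toReal * F (e x)
      = ∑ i ∈ Finset.range (Fintype.card α * K), p i * F i := by
    intro F
    rw [← Finset.sum_subset (Finset.range_mono (Nat.le_mul_of_pos_right _ hK)), Finset.sum_range,
      ← e.sum_comp]
    · refine Finset.sum_congr rfl fun x _ => ?_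
      simp [hp]
    · intro i _ hi
      have hi' : ¬ i < Fintype.card α := by simpa using hi
      simp only [hp, dif_neg hi', zero_mul]
  rw [hsum fun i => (min ((i : ℝ) + 1) K) ^ ρ, hsum fun i => (((i % K : ℕ) : ℝ) + 1) ^ ρ]
  exact sum_min_rpow_le_sum_mod_rpow hpanti hp0 hρ hK _

/-- Messages are encoded by describing their rank in a given enumeration. -/
theorem exists_isLengthFunction_rank [Nonempty α] (P : PMF α) (e : α ≃ Fin (Fintype.card α))
    {ρ M K : ℝ} (hρ : 0 ≤ ρ) (hM : Real.exp M ≤ K) :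
    ∃ L : α → ℕ, IsLengthFunction L ∧
      ∑ x, (P x).toReal * Real.exp (ρ * min ((L x : ℝ) * Real.log 2) M)
        ≤ (2 * (1 + Real.log (Fintype.card α))) ^ ρ
          * ∑ x, (P x).toReal * (min (((e x : ℕ) : ℝ) + 1) K) ^ ρ := by
  set H : ℝ := 1 + Real.log (Fintype.card α) with hH
  have hH1 : 1 ≤ H := le_add_of_nonneg_right (Real.log_natCast_nonneg _)
  have hK : 0 < K := (Real.exp_pos M).trans_le hM
  -- Weights inversely proportional to the rank, normalized by the logarithmic bound on the harmonic
  -- number.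
  obtain ⟨L, hL, hLw⟩ := exists_isLengthFunction (fun x => ((((e x : ℕ) : ℝ) + 1))⁻¹ / H)
    (fun x => by positivity) (by
      rw [← Finset.sum_div, div_le_one (by positivity)]
      refine le_trans (le_of_eq ?_) (harmonic_le_one_add_log (Fintype.card α))
      rw [e.sum_comp (fun i : Fin (Fintype.card α) => (((i : ℕ) : ℝ) + 1)⁻¹), harmonic,
        Rat.cast_sum, Finset.sum_range]
      simp)
  refine ⟨L, hL, ?_⟩
  rw [Finset.mul_sum]
  refine Finset.sum_le_sum fun x _ => ?_
  rw [mul_left_comm]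
  refine mul_le_mul_of_nonneg_left ?_ ENNReal.toReal_nonneg
  rw [← Real.mul_rpow (by positivity) (by positivity), mul_comm ρ, Real.exp_mul]
  refine Real.rpow_le_rpow (by positivity) ?_ hρ
  rw [mul_min_of_nonneg _ _ (by positivity)]
  refine le_min ?_ ?_
  · refine (Real.exp_le_exp.2 ((min_le_left _ _).trans (hLw x))).trans_eq ?_
    rw [← Real.log_inv, Real.exp_add, Real.exp_log (by positivity), Real.exp_log two_pos]
    field_simp
  · refine (Real.exp_le_exp.2 (min_le_right _ _)).trans (hM.trans ?_)
    exact le_mul_of_one_le_left hK.le (by linarith)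

end Guessing

/-! ### The guessing exponents equal the compression exponents -/

section Exponents

variable {A : Type*} [Fintype A]

theorem keyLength_mul_log_two_le {R : ℝ} (hR : 0 ≤ R) (n : ℕ) :
    (keyLength R n : ℝ) * Real.log 2 ≤ n * R + Real.log 2 := by
  have hl2 : 0 < Real.log 2 := Real.log_pos one_lt_two
  have h := (Nat.ceil_lt_add_one (div_nonneg (mul_nonneg n.cast_nonneg hR) hl2.le)).le
  have := mul_le_mul_of_nonneg_right h hl2.le
  rwa [add_mul, div_mul_cancel₀ _ hl2.ne', one_mul] at this

theorem exp_le_two_pow_keyLength (R : ℝ) (n : ℕ) :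
    Real.exp (n * R) ≤ ((2 ^ keyLength R n : ℕ) : ℝ) := by
  have hl2 : 0 < Real.log 2 := Real.log_pos one_lt_two
  have h := Nat.le_ceil ((n : ℝ) * R / Real.log 2)
  rw [div_le_iff₀ hl2] at h
  refine (Real.exp_le_exp.2 h).trans_eq ?_
  rw [Real.exp_nat_mul, Real.exp_log two_pos, Nat.cast_pow]
  rfl

theorem guessingExponent_le_add (X : Source A) {R ρ : ℝ} (hR : 0 ≤ R) (hρ : 0 < ρ) {n : ℕ}
    (hn : 0 < n) :
    guessingExponent X R ρ n
      ≤ ((ρ * Real.log 4 * (n : ℝ)⁻¹ : ℝ) : EReal) + compressionExponent X R ρ n := by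
  have hn' : (0 : ℝ) < n := by exact_mod_cast hn
  refine iSup_le fun f => iSup_le fun hf => iSup_le fun G => iSup_le fun hG => ?_
  refine le_coe_add_of_sub_le (le_compressionExponent hn fun L hL => ?_)
  have h1 := hG.guessingMoment_le_cost hf hL hρ (keyLength_mul_log_two_le hR n)
  have h2 := Real.log_le_log (zero_lt_one.trans_le (one_le_guessingMoment (X n) f G hρ.le)) h1
  rw [Real.log_mul (by positivity) (sum_mul_exp_pos _ _).ne', Real.log_rpow (by norm_num)] at h2
  rw [compressionCost, mul_sub, mul_inv_cancel_left₀ hn'.ne', mul_comm _ (n : ℝ)⁻¹,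
    mul_inv_cancel_left₀ hn'.ne']
  linarith

/-- The harmonic normalization at blocklength `n` is at most a constant times `n`; this is the
source of the error `ρ log n / n`. -/
theorem compressionExponent_le_add (X : Source A) {R ρ : ℝ} (hρ : 0 < ρ) {n : ℕ} (hn : 0 < n) :
    compressionExponent X R ρ n
      ≤ (((ρ * Real.log (2 * (1 + Real.log (Fintype.card A))) + Real.log (ρ + 2)) * (n : ℝ)⁻¹
          + ρ * (Real.log n / n) : ℝ) : EReal) + guessingExponent X R ρ n := by
  have := nonempty_of_source X
  have hn1 : (1 : ℝ) ≤ n := by exact_mod_cast hn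
  have hn' : (0 : ℝ) < n := by linarith
  obtain ⟨e, he, f, G, hf, hG, hrank⟩ := exists_encryption_le_guessingMoment (X n) (keyLength R n)
  have hguess : (((n : ℝ)⁻¹ * Real.log (guessingMoment (X n) f G ρ) : ℝ) : EReal)
      ≤ guessingExponent X R ρ n :=
    le_iSup_of_le f (le_iSup_of_le hf (le_iSup_of_le G (le_iSup_of_le hG le_rfl)))
  refine le_trans ?_ (add_le_add_right hguess _)
  rw [← EReal.coe_add]
  refine compressionExponent_le hn ?_
  obtain ⟨L, hL, hcost⟩ := exists_isLengthFunction_rank (X n) e hρ.le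
    (exp_le_two_pow_keyLength R n)
  refine ⟨L, hL, ?_⟩
  have h1 := sum_min_rank_rpow_le (X n) he hρ.le (K := 2 ^ keyLength R n) (by positivity)
  have h2 : ∑ x, (X n x).toReal * ((((e x : ℕ) % 2 ^ keyLength R n : ℕ) : ℝ) + 1) ^ ρ
      ≤ guessingMoment (X n) f G ρ := by
    rw [guessingMoment]
    refine Finset.sum_le_sum fun x _ => ?_
    rw [← sum_key_eq (k := keyLength R n) ((X n x).toReal * _)]
    refine Finset.sum_le_sum fun u _ => ?_
    rw [mul_right_comm]
    have : (((e x : ℕ) % 2 ^ keyLength R n : ℕ) : ℝ) ≤ ((G (f x u) x : ℕ) : ℝ) := by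
      exact_mod_cast hrank x u
    gcongr
  have hm := one_le_guessingMoment (X n) f G hρ.le
  have ha : 0 ≤ Real.log (Fintype.card A) := Real.log_natCast_nonneg _
  have hH : 2 * (1 + Real.log (Fintype.card (Fin n → A)))
      ≤ 2 * (1 + Real.log (Fintype.card A)) * n := by
    rw [log_card_words]
    nlinarith
  have hH0 : 0 ≤ 2 * (1 + Real.log (Fintype.card (Fin n → A))) := by
    have := Real.log_natCast_nonneg (Fintype.card (Fin n → A))
    positivity
  have h3 : compressionCost (X n) R ρ L
      ≤ (2 * (1 + Real.log (Fintype.card A)) * n) ^ ρ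
        * ((ρ + 2) * guessingMoment (X n) f G ρ) := by
    refine hcost.trans (mul_le_mul (Real.rpow_le_rpow hH0 hH hρ.le) (h1.trans ?_) ?_ ?_)
    · gcongr
    · exact Finset.sum_nonneg fun x _ => by positivity
    · positivity
  have h4 := Real.log_le_log (sum_mul_exp_pos _ _) h3
  have ha' : 0 < 2 * (1 + Real.log (Fintype.card A)) := by positivity
  have hρ2 : ρ + 2 ≠ 0 := by positivity
  rw [Real.log_mul (by positivity) (by positivity), Real.log_rpow (by positivity),
    Real.log_mul ha'.ne' hn'.ne', Real.log_mul hρ2 (by positivity)] at h4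
  refine h4.trans (le_of_eq ?_)
  generalize Real.log (guessingMoment (X n) f G ρ) = a
  generalize Real.log (2 * (1 + Real.log (Fintype.card A))) = b
  generalize Real.log (ρ + 2) = c
  field_simp
  ring

theorem tendsto_log_div_natCast : Tendsto (fun n : ℕ => Real.log n / n) atTop (𝓝 0) := by
  have h := (Real.tendsto_pow_log_div_mul_add_atTop 1 0 1 one_ne_zero).comp
    tendsto_natCast_atTop_atTop
  simpa [Function.comp_def] using h

theorem guessingExponents_eq (X : Source A) {R ρ : ℝ} (hR : 0 ≤ R) (hρ : 0 < ρ) :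
    lowerGuessingExponent X R ρ = lowerCompressionExponent X R ρ ∧
      upperGuessingExponent X R ρ = upperCompressionExponent X R ρ := by
  have e1 := tendsto_const_mul_inv_natCast (ρ * Real.log 4)
  have e2 : Tendsto (fun n : ℕ =>
      (ρ * Real.log (2 * (1 + Real.log (Fintype.card A))) + Real.log (ρ + 2)) * (n : ℝ)⁻¹
        + ρ * (Real.log n / n)) atTop (𝓝 0) := by
    simpa using (tendsto_const_mul_inv_natCast _).add (tendsto_log_div_natCast.const_mul ρ)
  have h1 : ∀ᶠ n : ℕ in atTop, guessingExponent X R ρ n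
      ≤ ((ρ * Real.log 4 * (n : ℝ)⁻¹ : ℝ) : EReal) + compressionExponent X R ρ n := by
    filter_upwards [eventually_gt_atTop 0] with n hn using guessingExponent_le_add X hR hρ hn
  have h2 : ∀ᶠ n : ℕ in atTop, compressionExponent X R ρ n
      ≤ (((ρ * Real.log (2 * (1 + Real.log (Fintype.card A))) + Real.log (ρ + 2)) * (n : ℝ)⁻¹
          + ρ * (Real.log n / n) : ℝ) : EReal) + guessingExponent X R ρ n := by
    filter_upwards [eventually_gt_atTop 0] with n hn using compressionExponent_le_add X hρ hn
  refine ⟨le_antisymm ?_ ?_, le_antisymm ?_ ?_⟩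
  · exact (liminf_le_add_liminf e1 h1).trans_eq (by rw [EReal.coe_zero, zero_add]; rfl)
  · exact (liminf_le_add_liminf e2 h2).trans_eq (by rw [EReal.coe_zero, zero_add]; rfl)
  · exact (limsup_le_add_limsup e1 h1).trans_eq (by rw [EReal.coe_zero, zero_add]; rfl)
  · exact (limsup_le_add_limsup e2 h2).trans_eq (by rw [EReal.coe_zero, zero_add]; rfl)

end Exponents

end GuessingWiretapper

theorem mainTheorem1 {A : Type*} [Fintype A] (X : Source A) (R ρ : ℝ) (hR : 0 < R) (hρ : 0 < ρ) :
    -- the lower bound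
    max (((ρ * R : ℝ) : EReal) -
          ⨅ (Y : Source A) (_ : (R : EReal) < infEntropyRate Y), upperDivergence Y X)
        (⨆ (Y : Source A) (_ : supEntropyRate Y ≤ (R : EReal)), lowerGap Y X ρ)
      ≤ lowerCompressionExponent X R ρ ∧
    lowerCompressionExponent X R ρ ≤ upperCompressionExponent X R ρ ∧
    -- the upper bound
    upperCompressionExponent X R ρ
      ≤ ⨅ θ ∈ Set.Icc (0 : ℝ) ρ, ((((ρ - θ) * R : ℝ) : EReal) + ⨆ Y : Source A, upperGap Y X θ) ∧
    -- the supremum over sources and the infimum over `θ` in the upper bound are attained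
    (∀ θ ∈ Set.Icc (0 : ℝ) ρ, ∃ Y' : Source A, upperGap Y' X θ = ⨆ Y : Source A, upperGap Y X θ) ∧
    (∃ θ' ∈ Set.Icc (0 : ℝ) ρ,
      (((ρ - θ') * R : ℝ) : EReal) + (⨆ Y : Source A, upperGap Y X θ')
        = ⨅ θ ∈ Set.Icc (0 : ℝ) ρ,
            ((((ρ - θ) * R : ℝ) : EReal) + ⨆ Y : Source A, upperGap Y X θ)) ∧
    -- the guessing exponents of the cipher system coincide with the compression exponents
    lowerGuessingExponent X R ρ = lowerCompressionExponent X R ρ ∧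
    upperGuessingExponent X R ρ = upperCompressionExponent X R ρ := by
  have hg := guessingExponents_eq X hR.le hρ
  refine ⟨max_le (rate_sub_le_lowerCompressionExponent X hR hρ)
      (iSup₂_le fun Y hY => lowerGap_le_lowerCompressionExponent hR hρ hY),
    liminf_le_limsup, le_iInf₂ fun θ hθ => upperCompressionExponent_le X hθ,
    fun θ hθ => exists_upperGap_eq_iSup X hθ.1, exists_minimizing_tilt X R hρ.le, hg.1, hg.2⟩
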